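/- Let $d\ge 1$. For $z=(x,\omega)\in\mathbb{R}^{2d}$ let $\pi(z)$ be the unitary operator on $L^2(\mathbb{R}^d)$ given by $\pi(z)\psi(t)=e^{2\pi i\omega\cdot t}\psi(t-x)$, let $P\psi(t)=\psi(-t)$, and for a bounded operator $A$ on $L^2(\mathbb{R}^d)$ put $\alpha_z(A)=\pi(z)A\pi(z)^*$ and $\check A=PAP$. For trace class operators $S,T$ and $f\in L^1(\mathbb{R}^{2d})$ define the function $S\star T(z)=\mathrm{tr}(S\,\alpha_z(\check T))$ and the operator $f\star S=\int_{\mathbb{R}^{2d}} f(z)\,\alpha_z(S)\,dz$ (weak integral), and let $\tilde S=S\star\check S$. Let $M^*_{op}$ be the set of positive trace class operators $S$ on $L^2(\mathbb{R}^d)$ with $\mathrm{tr}(S)=1$ and $\|S\|_{M^*_{op}}^2:=\int_{\mathbb{R}^{2d}}\tilde S(z)\,|z|\,dz<\infty$, where $|z|$ is the Euclidean norm. Let $S\in M^*_{op}$ and let $\Omega\subset\mathbb{R}^{2d}$ be a compact set with Lebesgue measure $|\Omega|>0$ and finite perimeter $|\partial\Omega|:=\mathrm{Var}(\chi_\Omega)=\sup\{\int_\Omega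 \mathrm{div}\,F\,dz : F\in C^1_c(\mathbb{R}^{2d};\mathbb{R}^{2d}),\ |F|\le 1\}<\infty$. Let $\chi_\Omega\star S=\sum_{k=1}^\infty\lambda_k\,h_k\otimes h_k$ (convergence in operator norm) be a spectral representation with $\lambda_1\ge\lambda_2\ge\cdots$ and $(h_k)_{k\ge1}$ an orthonormal sequence of eigenfunctions, where $(h\otimes h)\xi=\langle\xi,h\rangle h$. Define the accumulated Cohen class distribution $$\rho^S_\Omega(z)=\sum_{k=1}^{\lceil|\Omega|\rceil}Q_S(h_k)(z),\qquad Q_S(h)=\check S\star(h\otimes h).$$ Then $\rho^S_\Omega-\chi_\Omega*\tilde S$ is integrable on $\mathbb{R}^{2d}$ and $$\frac1{|\Omega|}\,\bigl\|\rho^S_\Omega-\chi_\Omega*\tilde S\bigr\|_{L^1}\le\frac1{|\Omega|}+4\,\|S\|_{M^*_{op}}\sqrt{\frac{|\partial\Omega|}{|\Omega|}} .$$ -/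

import Mathlib

open MeasureTheory Filter Topology
open scoped ENNReal NNReal

noncomputable section

namespace CohenClass

/-! ### Time-frequency shifts on `L²(ℝ^d)` -/

/-- The configuration space `ℝ^d` with its Euclidean structure and Lebesgue measure. -/
abbrev Conf (d : ℕ) : Type := EuclideanSpace ℝ (Fin d)

/-- The phase space `ℝ^{2d}`, with points `z = (x, ω)` and Lebesgue measure. The product norm of
this type is not Euclidean; the Euclidean norm is `euclNorm`. -/
abbrev Phase (d : ℕ) : Type := Conf d × Conf d

/-- The Hilbert space `L²(ℝ^d)`. -/
abbrev L2 (d : ℕ) : Type := Lp ℂ 2 (volume : Measure (Conf d))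

/-- Bounded operators on `L²(ℝ^d)`. -/
abbrev Op (d : ℕ) : Type := L2 d →L[ℂ] L2 d

/-- The Euclidean norm `|z|` on `ℝ^{2d}`. -/
def euclNorm {d : ℕ} (z : Phase d) : ℝ := √(‖z.1‖ ^ 2 + ‖z.2‖ ^ 2)

theorem compMeasurePreserving_cancel {d : ℕ} {f g : Conf d → Conf d}
    (hf : MeasurePreserving f volume volume) (hg : MeasurePreserving g volume volume)
    (hfg : ∀ t, f (g t) = t) (ψ : L2 d) :
    Lp.compMeasurePreserving g hg (Lp.compMeasurePreserving f hf ψ) = ψ := by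
  have key : ∀ (k : Conf d → Conf d) (hk : MeasurePreserving k volume volume), k = id →
      Lp.compMeasurePreserving k hk ψ = ψ := by
    rintro _ hk rfl
    exact Lp.compMeasurePreserving_id_apply ψ
  exact (Lp.compMeasurePreserving_comp_apply ψ hf hg).symm.trans (key _ _ (funext hfg))

/-- The translation operator `(T_x ψ)(t) = ψ(t - x)`. -/
def translation {d : ℕ} (x : Conf d) : L2 d ≃ₗᵢ[ℂ] L2 d :=
  LinearIsometryEquiv.mk
    (LinearEquiv.ofLinearMap
      (Lp.compMeasurePreservingₗ ℂ (fun t : Conf d => t - x)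
        (measurePreserving_sub_right volume x))
      (Lp.compMeasurePreservingₗ ℂ (fun t : Conf d => t + x)
        (measurePreserving_add_right volume x))
      (LinearMap.ext fun ψ => compMeasurePreserving_cancel
        (measurePreserving_add_right volume x) (measurePreserving_sub_right volume x)
        (fun t => sub_add_cancel t x) ψ)
      (LinearMap.ext fun ψ => compMeasurePreserving_cancel
        (measurePreserving_sub_right volume x) (measurePreserving_add_right volume x)
        (fun t => add_sub_cancel_right t x) ψ))
    (fun ψ => Lp.norm_compMeasurePreserving ψ (measurePreserving_sub_right volume x))

theorem coeFn_translation {d : ℕ} (x : Conf d) (ψ : L2 d) :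
    translation x ψ =ᵐ[volume] fun t => ψ (t - x) :=
  Lp.coeFn_compMeasurePreserving ψ (measurePreserving_sub_right volume x)

theorem memLp_modulation {d : ℕ} (ω : Conf d) (ψ : L2 d) :
    MemLp (fun t : Conf d => (Real.fourierChar (inner ℝ ω t) : ℂ) * ψ t) 2 volume := by
  refine (Lp.memLp ψ).of_le ?_ (Eventually.of_forall fun t => by
    rw [norm_mul, Circle.norm_coe, one_mul])
  refine AEStronglyMeasurable.mul ?_ (Lp.aestronglyMeasurable ψ)
  exact (continuous_subtype_val.comp (Real.continuous_fourierChar.comp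
    (by fun_prop))).aestronglyMeasurable

/-- The modulation operator `(M_ω ψ)(t) = e^{2πi ω·t} ψ(t)`, as a linear map. -/
def modulationLin {d : ℕ} (ω : Conf d) : L2 d →ₗ[ℂ] L2 d where
  toFun ψ := (memLp_modulation ω ψ).toLp _
  map_add' ψ φ := by
    rw [← MemLp.toLp_add]
    refine MemLp.toLp_congr _ _ ?_
    filter_upwards [Lp.coeFn_add ψ φ] with t ht
    rw [Pi.add_apply, ← mul_add, ht, Pi.add_apply]
  map_smul' c ψ := by
    rw [RingHom.id_apply, ← MemLp.toLp_const_smul]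
    refine MemLp.toLp_congr _ _ ?_
    filter_upwards [Lp.coeFn_smul c ψ] with t ht
    simp only [ht, Pi.smul_apply, smul_eq_mul]
    ring

theorem coeFn_modulationLin {d : ℕ} (ω : Conf d) (ψ : L2 d) :
    modulationLin ω ψ =ᵐ[volume] fun t => (Real.fourierChar (inner ℝ ω t) : ℂ) * ψ t :=
  MemLp.coeFn_toLp (memLp_modulation ω ψ)

theorem modulationLin_comp_neg {d : ℕ} (ω : Conf d) :
    modulationLin ω ∘ₗ modulationLin (-ω) = LinearMap.id := by
  ext1 ψ
  refine Lp.ext ?_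
  filter_upwards [coeFn_modulationLin ω (modulationLin (-ω) ψ), coeFn_modulationLin (-ω) ψ]
    with t h1 h2
  simp only [LinearMap.comp_apply, LinearMap.id_apply]
  rw [h1, h2, ← mul_assoc, ← Circle.coe_mul, ← AddChar.map_add_eq_mul]
  simp

/-- The modulation operator `(M_ω ψ)(t) = e^{2πi ω·t} ψ(t)`. -/
def modulation {d : ℕ} (ω : Conf d) : L2 d ≃ₗᵢ[ℂ] L2 d :=
  LinearIsometryEquiv.mk
    (LinearEquiv.ofLinearMap (modulationLin ω) (modulationLin (-ω)) (modulationLin_comp_neg ω)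
      (by simpa using modulationLin_comp_neg (-ω)))
    (fun ψ => by
      refine le_antisymm ?_ ?_ <;>
      · refine Lp.norm_le_norm_of_ae_le ?_
        filter_upwards [coeFn_modulationLin ω ψ] with t ht
        simp only [LinearEquiv.coe_ofLinearMap]
        rw [ht, norm_mul, Circle.norm_coe, one_mul])

theorem coeFn_modulation {d : ℕ} (ω : Conf d) (ψ : L2 d) :
    modulation ω ψ =ᵐ[volume] fun t => (Real.fourierChar (inner ℝ ω t) : ℂ) * ψ t :=
  coeFn_modulationLin ω ψ

/-- The time-frequency shift `π(z) = M_ω T_x` for `z = (x, ω)`, a unitary operator. -/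
def tfShift {d : ℕ} (z : Phase d) : L2 d ≃ₗᵢ[ℂ] L2 d :=
  (translation z.1).trans (modulation z.2)

/-- The parity operator `(P ψ)(t) = ψ(-t)`. -/
def parity (d : ℕ) : Op d :=
  (Lp.compMeasurePreservingₗᵢ ℂ (fun t : Conf d => -t)
    (Measure.measurePreserving_neg volume)).toContinuousLinearMap

/-- The translate `α_z(A) = π(z) A π(z)^*` of an operator. -/
def alpha {d : ℕ} (z : Phase d) (A : Op d) : Op d :=
  (tfShift z : Op d) ∘L A ∘L ContinuousLinearMap.adjoint (tfShift z : Op d)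

/-- The involution `Ǎ = P A P`. -/
def check {d : ℕ} (A : Op d) : Op d := parity d ∘L A ∘L parity d

/-! ### Trace class operators -/

/-- The index set of a fixed orthonormal basis of a Hilbert space. -/
def basisIndex (E : Type*) [NormedAddCommGroup E] [InnerProductSpace ℂ E] [CompleteSpace E] :
    Set E :=
  (exists_hilbertBasis ℂ E).choose

/-- A fixed orthonormal basis of a Hilbert space. The trace of a trace class operator does not
depend on the choice of the basis. -/
def basis (E : Type*) [NormedAddCommGroup E] [InnerProductSpace ℂ E] [CompleteSpace E] :
    HilbertBasis (basisIndex E) ℂ E :=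
  (exists_hilbertBasis ℂ E).choose_spec.choose

/-- The trace `tr(T) = ∑ ⟨T e_k, e_k⟩` over an orthonormal basis (the inner product of Mathlib is
linear in its second argument). -/
def opTrace {E : Type*} [NormedAddCommGroup E] [InnerProductSpace ℂ E] [CompleteSpace E]
    (T : E →L[ℂ] E) : ℂ :=
  ∑' i, inner ℂ (basis E i) (T (basis E i))

/-- `T` is trace class: it is compact and `tr(|T|) < ∞`, where `|T| = √(T^* T)`. -/
def IsTraceClass {E : Type*} [NormedAddCommGroup E] [InnerProductSpace ℂ E] [CompleteSpace E]
    (T : E →L[ℂ] E) : Prop :=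
  IsCompactOperator T ∧
    Summable fun i => (inner ℂ (basis E i) (CFC.abs T (basis E i)) : ℂ)

/-- A density operator: a positive trace class operator of trace one. -/
def IsDensityOperator {d : ℕ} (S : Op d) : Prop :=
  IsTraceClass S ∧ S.IsPositive ∧ opTrace S = 1

/-! ### Convolutions of quantum harmonic analysis -/

/-- The function `S ⋆ T (z) = tr(S α_z(Ť))` for operators `S`, `T`. -/
def opConv {d : ℕ} (S T : Op d) (z : Phase d) : ℂ := opTrace (S ∘L alpha z (check T))

/-- The function `S̃ = S ⋆ Š`. -/
def tilde {d : ℕ} (S : Op d) : Phase d → ℂ := opConv S (check S)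

theorem continuous_translation {d : ℕ} (ψ : L2 d) :
    Continuous fun x : Conf d => translation x ψ := by
  have hg : Continuous fun x : Conf d =>
      (ContinuousMap.curry ⟨fun q : Conf d × Conf d => q.2 - q.1, by fun_prop⟩ :
        C(Conf d, C(Conf d, Conf d))) x := ContinuousMap.continuous _
  have hψ : Continuous fun _ : Conf d => ψ := continuous_const
  exact hψ.compMeasurePreservingLp hg (fun x => measurePreserving_sub_right volume x) (by simp)

/-- A family of isometries that is strongly continuous is jointly continuous. -/
theorem continuous_isometry_family {E X : Type*} [NormedAddCommGroup E]
    [NormedSpace ℂ E] [TopologicalSpace X]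
    (U : X → E ≃ₗᵢ[ℂ] E) (hU : ∀ ψ, Continuous fun x => U x ψ) {g : X → E}
    (hg : Continuous g) : Continuous fun x => U x (g x) := by
  rw [continuous_iff_continuousAt]
  intro x₀
  have h1 : Tendsto (fun x => U x (g x₀)) (𝓝 x₀) (𝓝 (U x₀ (g x₀))) :=
    (hU (g x₀)).continuousAt
  have h2 : Tendsto (fun x => U x (g x - g x₀)) (𝓝 x₀) (𝓝 0) := by
    rw [tendsto_zero_iff_norm_tendsto_zero]
    simp only [LinearIsometryEquiv.norm_map]
    exact tendsto_iff_norm_sub_tendsto_zero.1 hg.continuousAt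
  have h3 := h1.add h2
  simp only [map_sub, add_sub_cancel, add_zero] at h3
  exact h3

theorem continuous_isometry_family_symm {E X : Type*} [NormedAddCommGroup E]
    [NormedSpace ℂ E] [TopologicalSpace X] (U : X → E ≃ₗᵢ[ℂ] E)
    (hU : ∀ ψ, Continuous fun x => U x ψ) (ψ : E) : Continuous fun x => (U x).symm ψ := by
  rw [continuous_iff_continuousAt]
  intro x₀
  rw [ContinuousAt, tendsto_iff_norm_sub_tendsto_zero]
  have h := tendsto_iff_norm_sub_tendsto_zero.1 ((hU ((U x₀).symm ψ)).tendsto x₀)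
  refine h.congr fun x => ?_
  rw [← LinearIsometryEquiv.norm_map (U x) ((U x).symm ψ - _), map_sub,
    LinearIsometryEquiv.apply_symm_apply, LinearIsometryEquiv.apply_symm_apply, norm_sub_rev]

theorem continuous_modulation {d : ℕ} (ψ : L2 d) :
    Continuous fun ω : Conf d => modulation ω ψ := by
  have key : ∀ φ : L2 d, Continuous fun ω : Conf d => (inner ℂ φ (modulation ω ψ) : ℂ) := by
    intro φ
    have hrw : ∀ ω : Conf d, (inner ℂ φ (modulation ω ψ) : ℂ) =
        ∫ t, (Real.fourierChar (inner ℝ ω t) : ℂ) * inner ℂ (φ t) (ψ t) := by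
      intro ω
      rw [L2.inner_def]
      refine integral_congr_ae ?_
      filter_upwards [coeFn_modulation ω ψ] with t ht
      rw [ht, ← smul_eq_mul, inner_smul_right]
    simp only [hrw]
    refine continuous_of_dominated (bound := fun t => ‖(inner ℂ (φ t) (ψ t) : ℂ)‖) ?_ ?_ ?_ ?_
    · intro ω
      refine AEStronglyMeasurable.mul ?_ (L2.integrable_inner φ ψ).aestronglyMeasurable
      exact (continuous_subtype_val.comp (Real.continuous_fourierChar.comp
        (by fun_prop))).aestronglyMeasurable
    · exact fun ω => Eventually.of_forall fun t => by rw [norm_mul, Circle.norm_coe, one_mul]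
    · exact (L2.integrable_inner φ ψ).norm
    · refine Eventually.of_forall fun t => ?_
      exact (continuous_subtype_val.comp (Real.continuous_fourierChar.comp
        (by fun_prop))).mul continuous_const
  rw [continuous_iff_continuousAt]
  intro ω₀
  rw [ContinuousAt, tendsto_iff_norm_sub_tendsto_zero]
  have hsq : Tendsto (fun ω => ‖modulation ω ψ - modulation ω₀ ψ‖ ^ 2) (𝓝 ω₀) (𝓝 0) := by
    have hlim : Tendsto (fun ω : Conf d => ‖ψ‖ ^ 2 -
        2 * (inner ℂ (modulation ω₀ ψ) (modulation ω ψ) : ℂ).re + ‖ψ‖ ^ 2) (𝓝 ω₀) (𝓝 0) := by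
      have hc : Continuous fun ω : Conf d => ‖ψ‖ ^ 2 -
          2 * (inner ℂ (modulation ω₀ ψ) (modulation ω ψ) : ℂ).re + ‖ψ‖ ^ 2 :=
        (continuous_const.sub (continuous_const.mul
          (Complex.continuous_re.comp (key (modulation ω₀ ψ))))).add continuous_const
      have h0 := hc.tendsto ω₀
      have hself : (inner ℂ (modulation ω₀ ψ) (modulation ω₀ ψ) : ℂ).re = ‖ψ‖ ^ 2 := by
        rw [LinearIsometryEquiv.inner_map_map, ← RCLike.re_eq_complex_re,
          inner_self_eq_norm_sq]
      rw [hself] at h0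
      convert h0 using 2
      ring
    refine hlim.congr fun ω => ?_
    rw [norm_sub_rev, norm_sub_sq (𝕜 := ℂ), LinearIsometryEquiv.norm_map,
      LinearIsometryEquiv.norm_map, RCLike.re_eq_complex_re]
  have := hsq.sqrt
  simpa [Real.sqrt_sq (norm_nonneg _)] using this

theorem continuous_tfShift {d : ℕ} (ψ : L2 d) : Continuous fun z : Phase d => tfShift z ψ := by
  have h2 : Continuous fun z : Phase d => translation z.1 ψ :=
    (continuous_translation ψ).comp continuous_fst
  have h3 : ∀ φ : L2 d, Continuous fun z : Phase d => modulation z.2 φ := fun φ =>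
    (continuous_modulation φ).comp continuous_snd
  exact continuous_isometry_family (fun z : Phase d => modulation z.2) h3 h2

theorem alpha_apply {d : ℕ} (z : Phase d) (A : Op d) (ψ : L2 d) :
    alpha z A ψ = tfShift z (A ((tfShift z).symm ψ)) := by
  rw [alpha, LinearIsometryEquiv.adjoint_eq_symm]
  rfl

theorem continuous_alpha {d : ℕ} (A : Op d) (ψ : L2 d) :
    Continuous fun z : Phase d => alpha z A ψ := by
  simp only [alpha_apply]
  exact continuous_isometry_family tfShift continuous_tfShift
    (A.continuous.comp (continuous_isometry_family_symm tfShift continuous_tfShift ψ))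

theorem norm_alpha_apply_le {d : ℕ} (z : Phase d) (A : Op d) (ψ : L2 d) :
    ‖alpha z A ψ‖ ≤ ‖A‖ * ‖ψ‖ := by
  rw [alpha_apply, LinearIsometryEquiv.norm_map]
  simpa using A.le_opNorm ((tfShift z).symm ψ)

theorem integrable_smul_alpha {d : ℕ} {f : Phase d → ℂ} (hf : Integrable f) (A : Op d)
    (ψ : L2 d) : Integrable fun z => f z • alpha z A ψ :=
  hf.smul_bdd (‖A‖ * ‖ψ‖) (continuous_alpha A ψ).aestronglyMeasurable
    (Eventually.of_forall fun z => norm_alpha_apply_le z A ψ)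

open scoped Classical in
/-- The operator `f ⋆ S = ∫ f(z) α_z(S) dz` for integrable `f` (and `0` for other `f`). The
integral converges pointwise on `L²(ℝ^d)`, hence weakly: see `inner_funConv`. -/
def funConv {d : ℕ} (f : Phase d → ℂ) (S : Op d) : Op d :=
  if hf : Integrable f then
    LinearMap.mkContinuous
      { toFun := fun ψ => ∫ z, f z • alpha z S ψ
        map_add' := fun ψ φ => by
          simp only [map_add, smul_add]
          exact integral_add (integrable_smul_alpha hf S ψ) (integrable_smul_alpha hf S φ)
        map_smul' := fun c ψ => by
          simp only [map_smul, RingHom.id_apply]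
          rw [← integral_smul]
          simp only [smul_comm c] }
      ((∫ z, ‖f z‖) * ‖S‖)
      (fun ψ => by
        refine (norm_integral_le_integral_norm _).trans ?_
        rw [mul_assoc, ← integral_mul_const]
        refine integral_mono (integrable_smul_alpha hf S ψ).norm (hf.norm.mul_const _) fun z => ?_
        simp only [norm_smul]
        gcongr
        exact norm_alpha_apply_le z S ψ)
  else 0

theorem inner_funConv {d : ℕ} {f : Phase d → ℂ} (hf : Integrable f) (S : Op d) (ψ ξ : L2 d) :
    (inner ℂ ξ (funConv f S ψ) : ℂ) = ∫ z, f z * inner ℂ ξ (alpha z S ψ) := by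
  rw [funConv, dif_pos hf]
  change (inner ℂ ξ (∫ z, f z • alpha z S ψ) : ℂ) = _
  rw [← integral_inner (integrable_smul_alpha hf S ψ)]
  simp only [inner_smul_right]

/-- The characteristic function `χ_Ω` with values in `ℂ`. -/
def charFn {d : ℕ} (Ω : Set (Phase d)) : Phase d → ℂ := Ω.indicator fun _ => 1

/-- The convolution `χ_Ω ∗ S̃` of functions on `ℝ^{2d}`. -/
def charConvTilde {d : ℕ} (Ω : Set (Phase d)) (S : Op d) : Phase d → ℂ :=
  convolution (charFn Ω) (tilde S) (ContinuousLinearMap.mul ℂ ℂ) volume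

/-! ### Cohen's class and accumulated Cohen class distributions -/

/-- The rank-one operator `ψ ⊗ ψ : ξ ↦ ⟨ξ, ψ⟩ ψ`. -/
def tensorSelf {d : ℕ} (ψ : L2 d) : Op d := InnerProductSpace.rankOne ℂ ψ ψ

/-- The Cohen class distribution `Q_S(ψ) = Š ⋆ (ψ ⊗ ψ)`. -/
def cohen {d : ℕ} (S : Op d) (ψ : L2 d) : Phase d → ℂ := opConv (check S) (tensorSelf ψ)

/-- `T = ∑ λ_k h_k ⊗ h_k` is a spectral representation of `T`, convergent in operator norm, with
eigenvalues `λ_0 ≥ λ_1 ≥ …` and an orthonormal sequence of eigenfunctions `h_k`. The sequence is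
not required to be complete: when `T` has infinitely many nonzero eigenvalues as well as a
nontrivial kernel, no complete sequence of eigenfunctions is ordered by decreasing eigenvalues. -/
structure IsSpectralRepresentation {d : ℕ} (T : Op d) (ev : ℕ → ℝ) (h : ℕ → L2 d) : Prop where
  orthonormal : Orthonormal ℂ h
  antitone : Antitone ev
  hasSum : HasSum (fun k => (ev k : ℂ) • tensorSelf (h k)) T

/-- The accumulated Cohen class distribution `ρ = ∑_{k=1}^{A} Q_S(h_k)` with `A = ⌈|Ω|⌉`, where the
sequence `h` (indexed from `0`) is meant to consist of the eigenfunctions of `χ_Ω ⋆ S`. -/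
def accumulatedCohen {d : ℕ} (S : Op d) (Ω : Set (Phase d)) (h : ℕ → L2 d) (z : Phase d) : ℂ :=
  ∑ k ∈ Finset.range ⌈volume.real Ω⌉₊, cohen S (h k) z

/-! ### The class `M*_op` and the perimeter -/

/-- `S ∈ M*_op`: `S` is a density operator with `∫ S̃(z) |z| dz < ∞`. -/
def MemMopStar {d : ℕ} (S : Op d) : Prop :=
  IsDensityOperator S ∧ Integrable fun z : Phase d => tilde S z * (euclNorm z : ℂ)

/-- `‖S‖_{M*_op} = (∫ S̃(z) |z| dz)^{1/2}`; for density operators `S̃` is real and nonnegative. -/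
def mopStarNorm {d : ℕ} (S : Op d) : ℝ := √(∫ z : Phase d, (tilde S z).re * euclNorm z)

/-- The divergence of a vector field on `ℝ^{2d}`: the trace of its derivative. -/
def divergence {d : ℕ} (F : Phase d → Phase d) (z : Phase d) : ℝ :=
  LinearMap.trace ℝ (Phase d) (fderiv ℝ F z : Phase d →ₗ[ℝ] Phase d)

/-- The total variation of a locally integrable function: the supremum of `∫ f div F` over
compactly supported `C¹` vector fields `F` with `|F| ≤ 1` for the Euclidean norm. -/
def totalVariation {d : ℕ} (f : Phase d → ℝ) : ℝ≥0∞ :=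
  ⨆ (F : Phase d → Phase d) (_ : ContDiff ℝ 1 F) (_ : HasCompactSupport F)
    (_ : ∀ z, euclNorm (F z) ≤ 1), ENNReal.ofReal (∫ z, f z * divergence F z)

/-- The perimeter `|∂Ω| = Var(χ_Ω)`. -/
def perimeter {d : ℕ} (Ω : Set (Phase d)) : ℝ≥0∞ := totalVariation (Ω.indicator fun _ => (1 : ℝ))

end CohenClass

end

/-!
The idea is to write both functions in terms of the eigenfunctions `h_k` of `T = χ_Ω ⋆ S`. Each
`Q_S(h_k)(z) = ⟨α_z(S) h_k, h_k⟩` is nonnegative, has integral one by Moyal's identity, and has mass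
`⟨T h_k, h_k⟩ = λ_k` on `Ω` (`lintegral_enorm_alpha_sq`, `IsSpectralRepresentation.ev_eq`).
Computing the trace of `T α_z(S)` in two ways gives `χ_Ω ∗ S̃ = ∑ λ_k Q_S(h_k)`
(`IsSpectralRepresentation.tsum_enorm_alpha_sq`). Hence, with `N = ⌈|Ω|⌉`,
`‖ρ - χ_Ω ∗ S̃‖₁ ≤ ∑_{k < N} (1 - λ_k) + ∑_{k ≥ N} λ_k`, and since `∑ λ_k = |Ω|` and the `λ_k`
decrease in `[0, 1]`, the right-hand side is at most `1 + 2 ∑ λ_k (1 - λ_k)`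
(`tsum_sub_sum_range_le`).

Integrating `∑ λ_k Q_S(h_k)` over `Ω` gives `∑ λ_k²`, so that
`D = ∑ λ_k (1 - λ_k) = ∫_Ω (1 - χ_Ω ∗ S̃) = ∫ S̃(w) |Ω \ (Ω + w)| dw`. A set of finite perimeter
satisfies `|Ω \ (Ω + w)| ≤ |w| |∂Ω|` (`volume_diff_translate_le`), whence `D ≤ ‖S‖² |∂Ω|`.
Together with the trivial bound `D ≤ |Ω|` this yields `D ≤ ‖S‖ √(|∂Ω| |Ω|)`.

The positive operator `S` enters through its square root `R`, a self-adjoint Hilbert–Schmidt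
operator: `Q_S(h)(z) = ‖α_z(R) h‖²` and `S̃(z)` is the squared Hilbert–Schmidt norm of `α_z(R) R`
(`tilde_eq_overlap`), so that all sums and integrals can be interchanged as quantities in `[0, ∞]`.
Moyal's identity follows from Plancherel's theorem for functions in `L¹ ∩ L²`.
-/

noncomputable section

namespace CohenClass

/-! ### Plancherel's theorem and Moyal's identity -/

theorem enorm_sq_eq_lintegral {α : Type*} [MeasurableSpace α] {μ : Measure α}
    (u : Lp ℂ 2 μ) : ‖u‖ₑ ^ 2 = ∫⁻ t, ‖u t‖ₑ ^ 2 ∂μ := by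
  rw [Lp.enorm_def, eLpNorm_eq_lintegral_rpow_enorm_toReal (by norm_num) (by norm_num)]
  rw [← ENNReal.rpow_natCast, ← ENNReal.rpow_mul]
  simp

section Plancherel

open scoped FourierTransform

variable {V : Type*} [NormedAddCommGroup V] [InnerProductSpace ℝ V] [FiniteDimensional ℝ V]
  [MeasurableSpace V] [BorelSpace V]

theorem continuous_fourier {f : V → ℂ} (hf : Integrable f) : Continuous (𝓕 f) :=
  VectorFourier.fourierIntegral_continuous Real.continuous_fourierChar
    (by exact continuous_inner) hf

/-- On `L¹ ∩ L²` the Fourier integral represents the Fourier transform of `L²`, because both act in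
the same way on Schwartz functions. -/
theorem coeFn_fourier_toLp {f : V → ℂ} (h1 : Integrable f) (h2 : MemLp f 2) :
    ((𝓕 (h2.toLp f) : Lp ℂ 2 (volume : Measure V)) : V → ℂ) =ᵐ[volume] 𝓕 f := by
  refine ae_eq_of_integral_contDiff_smul_eq (μ := volume) ?_ (continuous_fourier h1).locallyIntegrable ?_
  · exact (Lp.memLp _).locallyIntegrable (p := 2) (by norm_num)
  · intro g hg hgc
    have hgc' : HasCompactSupport (fun x => (g x : ℂ)) := hgc.comp_left Complex.ofReal_zero
    let G : SchwartzMap V ℂ := hgc'.toSchwartzMap (Complex.ofRealCLM.contDiff.comp hg)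
    have hG : ∀ x, G x = (g x : ℂ) := fun x => rfl
    have e1 := congrArg (fun T => T G) (Lp.fourier_toTemperedDistribution_eq (h2.toLp f))
    simp only [TemperedDistribution.fourier_apply, Lp.toTemperedDistribution_apply] at e1
    have e2 : ∫ x, g x • ((𝓕 (h2.toLp f) : Lp ℂ 2 (volume : Measure V)) : V → ℂ) x =
        ∫ x, (𝓕 G) x • f x := by
      refine e1.symm.trans (integral_congr_ae ?_)
      filter_upwards [h2.coeFn_toLp] with x hx
      rw [hx]
    rw [e2, SchwartzMap.fourier_coe]
    have e3 := VectorFourier.integral_fourierIntegral_smul_eq_flip (e := Real.fourierChar)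
      (μ := volume) (ν := volume) (L := innerₗ V) (f := (G : V → ℂ)) (g := f)
      Real.continuous_fourierChar continuous_inner G.integrable h1
    rw [flip_innerₗ] at e3
    exact e3

theorem lintegral_enorm_sq_fourier {f : V → ℂ} (h1 : Integrable f) (h2 : MemLp f 2) :
    ∫⁻ ω, ‖𝓕 f ω‖ₑ ^ 2 = ∫⁻ t, ‖f t‖ₑ ^ 2 := by
  have e1 : ∫⁻ ω, ‖𝓕 f ω‖ₑ ^ 2 = ‖(𝓕 (h2.toLp f) : Lp ℂ 2 (volume : Measure V))‖ₑ ^ 2 := by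
    rw [enorm_sq_eq_lintegral]
    exact lintegral_congr_ae ((coeFn_fourier_toLp h1 h2).mono fun x hx => by simp only [hx])
  have e2 : ∫⁻ t, ‖f t‖ₑ ^ 2 = ‖h2.toLp f‖ₑ ^ 2 := by
    rw [enorm_sq_eq_lintegral]
    exact lintegral_congr_ae (h2.coeFn_toLp.mono fun x hx => by simp only [hx])
  rw [e1, e2, ← ofReal_norm, ← ofReal_norm, Lp.norm_fourier_eq]

end Plancherel

theorem tfShift_apply {d : ℕ} (z : Phase d) (ψ : L2 d) :
    tfShift z ψ = modulation z.2 (translation z.1 ψ) := rfl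

theorem coeFn_tfShift {d : ℕ} (z : Phase d) (ψ : L2 d) :
    tfShift z ψ =ᵐ[volume] fun t => (Real.fourierChar (inner ℝ z.2 t) : ℂ) * ψ (t - z.1) := by
  filter_upwards [coeFn_modulation z.2 (translation z.1 ψ), coeFn_translation z.1 ψ] with t h1 h2
  rw [tfShift_apply, h1, h2]

/-- Moyal's identity: up to the factor `‖φ‖ ‖ψ‖` the short-time Fourier transform is normalized
in `L²(ℝ^{2d})`. -/
theorem lintegral_enorm_inner_tfShift_sq {d : ℕ} (φ ψ : L2 d) :
    ∫⁻ z, ‖(inner ℂ φ (tfShift z ψ) : ℂ)‖ₑ ^ 2 = ‖φ‖ₑ ^ 2 * ‖ψ‖ₑ ^ 2 := by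
  open scoped FourierTransform in
  -- For fixed `x` the inner product is the Fourier transform of `F x` at `-ω`.
  let F : Conf d → Conf d → ℂ := fun x t => (starRingEnd ℂ) (φ t) * translation x ψ t
  have hφ : AEMeasurable (fun t => ‖φ t‖ₑ ^ 2) volume :=
    (Lp.aestronglyMeasurable φ).enorm.pow_const 2
  have hψ : AEMeasurable (fun t => ‖ψ t‖ₑ ^ 2) volume :=
    (Lp.aestronglyMeasurable ψ).enorm.pow_const 2
  have hF1 : ∀ x, Integrable (F x) := fun x =>
    MemLp.integrable_mul (Lp.memLp φ).star (Lp.memLp (translation x ψ))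
  have hFn : ∀ x, ∫⁻ t, ‖F x t‖ₑ ^ 2 = ∫⁻ t, ‖φ t‖ₑ ^ 2 * ‖ψ (t - x)‖ₑ ^ 2 := by
    intro x
    refine lintegral_congr_ae ?_
    filter_upwards [coeFn_translation x ψ] with t ht
    simp only [F, enorm_mul, mul_pow, ht]
    congr 2
    simp [enorm_eq_nnnorm]
  have hmeas : AEMeasurable (fun p : Conf d × Conf d => ‖φ p.2‖ₑ ^ 2 * ‖ψ (p.2 - p.1)‖ₑ ^ 2)
      (volume.prod volume) := by
    refine AEMeasurable.fun_mul ?_ ?_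
    · exact hφ.comp_quasiMeasurePreserving Measure.quasiMeasurePreserving_snd
    · refine hψ.comp_quasiMeasurePreserving (f := fun p : Conf d × Conf d => p.2 - p.1) ?_
      exact (quasiMeasurePreserving_sub volume volume).comp
        Measure.measurePreserving_swap.quasiMeasurePreserving
  have htot : ∫⁻ x, ∫⁻ t, ‖φ t‖ₑ ^ 2 * ‖ψ (t - x)‖ₑ ^ 2 = ‖φ‖ₑ ^ 2 * ‖ψ‖ₑ ^ 2 := by
    rw [lintegral_lintegral_swap hmeas]
    have : ∀ t, ∫⁻ x, ‖φ t‖ₑ ^ 2 * ‖ψ (t - x)‖ₑ ^ 2 = ‖φ t‖ₑ ^ 2 * ‖ψ‖ₑ ^ 2 := by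
      intro t
      rw [lintegral_const_mul' _ _ (by finiteness), enorm_sq_eq_lintegral ψ,
        lintegral_sub_left_eq_self (fun x => ‖ψ x‖ₑ ^ 2) t]
    simp only [this]
    rw [lintegral_mul_const' _ _ (by finiteness), ← enorm_sq_eq_lintegral]
  have hfin : ∀ᵐ x : Conf d, ∫⁻ t, ‖φ t‖ₑ ^ 2 * ‖ψ (t - x)‖ₑ ^ 2 < ∞ := by
    refine ae_lt_top' hmeas.lintegral_prod_right' ?_
    rw [htot]
    finiteness
  have hin : ∀ x ω, (inner ℂ φ (tfShift (x, ω) ψ) : ℂ) = 𝓕 (F x) (-ω) := by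
    intro x ω
    rw [L2.inner_def, Real.fourier_eq]
    refine integral_congr_ae ?_
    filter_upwards [coeFn_modulation ω (translation x ψ)] with t ht
    rw [tfShift_apply, ht, RCLike.inner_apply, inner_neg_right, neg_neg, real_inner_comm]
    simp only [F, Circle.smul_def, smul_eq_mul]
    ring
  have hcont : Continuous fun z : Phase d => ‖(inner ℂ φ (tfShift z ψ) : ℂ)‖ₑ ^ 2 :=
    (ENNReal.continuous_pow 2).comp
      (continuous_const.inner (continuous_tfShift ψ)).enorm
  rw [Measure.volume_eq_prod, lintegral_prod _ hcont.aemeasurable, ← htot]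
  refine lintegral_congr_ae ?_
  filter_upwards [hfin] with x hx
  have h2 : MemLp (F x) 2 := by
    refine ⟨(hF1 x).aestronglyMeasurable, ?_⟩
    rw [eLpNorm_lt_top_iff_lintegral_rpow_enorm_lt_top (by norm_num) (by norm_num)]
    simpa [hFn x] using hx
  simp only [hin]
  rw [lintegral_neg_eq_self (fun ω => ‖𝓕 (F x) ω‖ₑ ^ 2), lintegral_enorm_sq_fourier (hF1 x) h2,
    hFn x]

/-! ### Hilbert–Schmidt sums -/

section HilbertSchmidt

variable {E : Type*} [NormedAddCommGroup E] [InnerProductSpace ℂ E]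
  {ι κ : Type*}

open ContinuousLinearMap (adjoint)

/-- Parseval's identity with values in `[0, ∞]`. -/
theorem tsum_enorm_inner_sq (b : HilbertBasis ι ℂ E) (x : E) :
    ∑' i, ‖(inner ℂ (b i) x : ℂ)‖ₑ ^ 2 = ‖x‖ₑ ^ 2 := by
  have h := b.hasSum_inner_mul_inner x x
  have h1 : ∀ i, (inner ℂ x (b i) : ℂ) * inner ℂ (b i) x =
      ((‖(inner ℂ (b i) x : ℂ)‖ ^ 2 : ℝ) : ℂ) := by
    intro i
    rw [← inner_conj_symm, Complex.conj_mul']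
    push_cast
    rfl
  simp only [h1, inner_self_eq_norm_sq_to_K] at h
  have h2 : HasSum (fun i => ‖(inner ℂ (b i) x : ℂ)‖ ^ 2) (‖x‖ ^ 2) := by
    rw [← Complex.hasSum_ofReal]
    simpa using h
  simp only [← ofReal_norm]
  simp only [← ENNReal.ofReal_pow (norm_nonneg _)]
  rw [← ENNReal.ofReal_tsum_of_nonneg (fun i => by positivity) h2.summable, h2.tsum_eq]

theorem enorm_inner_comm (x y : E) : ‖(inner ℂ x y : ℂ)‖ₑ = ‖(inner ℂ y x : ℂ)‖ₑ := by
  rw [← ofReal_norm, ← ofReal_norm, norm_inner_symm]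

variable [CompleteSpace E]

/-- The square `∑ ‖X e_i‖²` of the Hilbert–Schmidt norm, with values in `[0, ∞]`, computed in the
fixed orthonormal basis. -/
def hsSq (X : E →L[ℂ] E) : ℝ≥0∞ := ∑' i, ‖X (basis E i)‖ₑ ^ 2

/-- The bases on the two sides are unrelated, so the Hilbert–Schmidt sum does not depend on the
basis either. -/
theorem tsum_enorm_apply_sq_adjoint (b : HilbertBasis ι ℂ E) (c : HilbertBasis κ ℂ E)
    (X : E →L[ℂ] E) : ∑' i, ‖X (b i)‖ₑ ^ 2 = ∑' j, ‖adjoint X (c j)‖ₑ ^ 2 := by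
  simp only [← tsum_enorm_inner_sq c (X _), ← tsum_enorm_inner_sq b (adjoint X _)]
  rw [ENNReal.tsum_comm]
  refine tsum_congr fun j => tsum_congr fun i => ?_
  rw [ContinuousLinearMap.adjoint_inner_right, enorm_inner_comm]

theorem hsSq_adjoint (X : E →L[ℂ] E) : hsSq (adjoint X) = hsSq X :=
  (tsum_enorm_apply_sq_adjoint _ _ X).symm

theorem hsSq_comp_le (B X : E →L[ℂ] E) : hsSq (B ∘L X) ≤ ‖B‖ₑ ^ 2 * hsSq X := by
  rw [hsSq, hsSq, ← ENNReal.tsum_mul_left]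
  refine ENNReal.tsum_le_tsum fun i => ?_
  rw [← mul_pow]
  gcongr
  exact B.le_opENorm _

theorem hsSq_congr {X Y : E →L[ℂ] E} (h : ∀ ψ, ‖X ψ‖ = ‖Y ψ‖) : hsSq X = hsSq Y := by
  simp only [hsSq, ← ofReal_norm, h]

theorem toReal_hsSq (X : E →L[ℂ] E) :
    (hsSq X).toReal = ∑' i, ‖X (basis E i)‖ ^ 2 := by
  rw [hsSq, ENNReal.tsum_toReal_eq (fun i => by finiteness)]
  simp

theorem summable_norm_inner_sq_prod {X : E →L[ℂ] E} (hX : hsSq X ≠ ∞) :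
    Summable fun p : basisIndex E × basisIndex E =>
      ‖(inner ℂ (basis E p.2) (X (basis E p.1)) : ℂ)‖ ^ 2 := by
  have h : ∑' p : basisIndex E × basisIndex E,
      ‖(inner ℂ (basis E p.2) (X (basis E p.1)) : ℂ)‖ₑ ^ 2 ≠ ∞ := by
    rw [ENNReal.tsum_prod (f := fun i j => ‖(inner ℂ (basis E j) (X (basis E i)) : ℂ)‖ₑ ^ 2)]
    simpa only [tsum_enorm_inner_sq, hsSq] using hX
  simpa using ENNReal.summable_toReal h

/-- The cyclicity of the trace for a product of two Hilbert–Schmidt operators. -/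
theorem tsum_inner_apply_comm {X Y : E →L[ℂ] E} (hX : hsSq X ≠ ∞) (hY : hsSq Y ≠ ∞) :
    ∑' i, (inner ℂ (X (basis E i)) (Y (basis E i)) : ℂ) =
      ∑' j, inner ℂ (adjoint Y (basis E j)) (adjoint X (basis E j)) := by
  let f : basisIndex E → basisIndex E → ℂ := fun i j =>
    inner ℂ (X (basis E i)) (basis E j) * inner ℂ (basis E j) (Y (basis E i))
  have hf : Summable (Function.uncurry f) := by
    refine Summable.of_norm_bounded
      ((summable_norm_inner_sq_prod hX).add (summable_norm_inner_sq_prod hY)) ?_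
    rintro ⟨i, j⟩
    simp only [Function.uncurry, f, norm_mul]
    rw [norm_inner_symm]
    nlinarith [sq_nonneg (‖(inner ℂ (basis E j) (X (basis E i)) : ℂ)‖ -
        ‖(inner ℂ (basis E j) (Y (basis E i)) : ℂ)‖),
      sq_nonneg ‖(inner ℂ (basis E j) (X (basis E i)) : ℂ)‖,
      sq_nonneg ‖(inner ℂ (basis E j) (Y (basis E i)) : ℂ)‖]
  have h1 : ∀ i, ∑' j, f i j = inner ℂ (X (basis E i)) (Y (basis E i)) := fun i =>
    (basis E).tsum_inner_mul_inner _ _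
  have h2 : ∀ j, ∑' i, f i j = inner ℂ (adjoint Y (basis E j)) (adjoint X (basis E j)) := by
    intro j
    rw [← (basis E).tsum_inner_mul_inner]
    refine tsum_congr fun i => ?_
    rw [ContinuousLinearMap.adjoint_inner_right, ContinuousLinearMap.adjoint_inner_left, mul_comm]
  simp only [← h1, ← h2]
  exact hf.tsum_comm.symm

/-- An orthonormal basis of a separable Hilbert space is countable: the balls of radius `1 / 2`
around its vectors are disjoint. -/
theorem countable_basisIndex [TopologicalSpace.SeparableSpace E] : Countable (basisIndex E) := by
  have hd : (Set.univ : Set (basisIndex E)).PairwiseDisjoint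
      (fun i => Metric.ball (basis E i) (1 / 2)) := by
    intro i _ j _ hij
    refine Metric.ball_disjoint_ball ?_
    have ho := (basis E).orthonormal
    have h2 : ‖basis E i - basis E j‖ ^ 2 = 2 := by
      rw [norm_sub_sq (𝕜 := ℂ), ho.1 i, ho.1 j, ho.2 hij]
      norm_num
    rw [dist_eq_norm]
    nlinarith [norm_nonneg (basis E i - basis E j)]
  have := hd.countable_of_isOpen (fun _ _ => Metric.isOpen_ball)
    (fun _ _ => Metric.nonempty_ball.2 (by norm_num))
  exact Set.countable_univ_iff.1 this

/-- The trace of `A (φ ⊗ φ)` is `⟨A φ, φ⟩`. -/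
theorem opTrace_comp_rankOne (A : E →L[ℂ] E) (φ : E) :
    opTrace (A ∘L InnerProductSpace.rankOne ℂ φ φ) = inner ℂ φ (A φ) := by
  rw [opTrace, ← (basis E).tsum_inner_mul_inner]
  refine tsum_congr fun i => ?_
  rw [ContinuousLinearMap.comp_apply, InnerProductSpace.rankOne_apply, map_smul, inner_smul_right]

end HilbertSchmidt

/-! ### The action of phase space on operators -/

section Alpha

variable {d : ℕ}

/-- Time-frequency shifts compose up to a phase factor. -/
theorem exists_phase_tfShift (z w : Phase d) :
    ∃ c : ℂ, ‖c‖ = 1 ∧ ∀ ψ, tfShift z (tfShift w ψ) = c • tfShift (z + w) ψ := by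
  refine ⟨(Real.fourierChar (-inner ℝ w.2 z.1) : ℂ), Circle.norm_coe _, fun ψ => Lp.ext ?_⟩
  have hw := (measurePreserving_sub_right volume z.1).quasiMeasurePreserving.ae
    (coeFn_tfShift w ψ)
  filter_upwards [coeFn_tfShift z (tfShift w ψ), hw, coeFn_tfShift (z + w) ψ,
    Lp.coeFn_smul (Real.fourierChar (-inner ℝ w.2 z.1) : ℂ) (tfShift (z + w) ψ)] with t h1 h2 h3 h4
  rw [h1, h2, h4, Pi.smul_apply, h3, smul_eq_mul, ← mul_assoc, ← mul_assoc, ← Circle.coe_mul,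
    ← Circle.coe_mul, ← AddChar.map_add_eq_mul, ← AddChar.map_add_eq_mul]
  rw [inner_sub_right, Prod.snd_add, inner_add_left, Prod.fst_add, sub_sub]
  congr 3
  ring

theorem tfShift_zero (ψ : L2 d) : tfShift 0 ψ = ψ := by
  refine Lp.ext ?_
  filter_upwards [coeFn_tfShift 0 ψ] with t ht
  rw [ht]
  simp

theorem exists_phase_tfShift_symm (z : Phase d) :
    ∃ c : ℂ, ‖c‖ = 1 ∧ ∀ ψ, (tfShift z).symm ψ = c • tfShift (-z) ψ := by
  obtain ⟨c, hc, h⟩ := exists_phase_tfShift (-z) z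
  refine ⟨c⁻¹, by simp [hc], fun ψ => ?_⟩
  have h0 : c ≠ 0 := fun h => by simp [h] at hc
  have := h ((tfShift z).symm ψ)
  rw [LinearIsometryEquiv.apply_symm_apply, neg_add_cancel, tfShift_zero] at this
  rw [this, inv_smul_smul₀ h0]

theorem conj_mul_self_of_norm_one {c : ℂ} (hc : ‖c‖ = 1) : (starRingEnd ℂ) c * c = 1 := by
  rw [Complex.conj_mul', hc]
  norm_num

theorem inner_alpha (z : Phase d) (A : Op d) (φ ψ : L2 d) :
    (inner ℂ φ (alpha z A ψ) : ℂ) = inner ℂ ((tfShift z).symm φ) (A ((tfShift z).symm ψ)) := by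
  rw [alpha_apply, ← LinearIsometryEquiv.inner_map_map (tfShift z) ((tfShift z).symm φ),
    LinearIsometryEquiv.apply_symm_apply]

/-- Since `π(z)^*` is a multiple of `π(-z)` by a phase factor, the two are interchangeable in
`α_z`. -/
theorem inner_alpha_eq_neg (z : Phase d) (A : Op d) (φ ψ : L2 d) :
    (inner ℂ φ (alpha z A ψ) : ℂ) = inner ℂ (tfShift (-z) φ) (A (tfShift (-z) ψ)) := by
  obtain ⟨c, hc, h⟩ := exists_phase_tfShift_symm z
  rw [inner_alpha, h, h, map_smul, inner_smul_left, inner_smul_right, ← mul_assoc,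
    conj_mul_self_of_norm_one hc, one_mul]

theorem alpha_alpha (z w : Phase d) (A : Op d) : alpha z (alpha w A) = alpha (z + w) A := by
  ext1 ψ
  refine ext_inner_left ℂ fun φ => ?_
  obtain ⟨c, hc, h⟩ := exists_phase_tfShift (-w) (-z)
  rw [inner_alpha_eq_neg, inner_alpha_eq_neg, h, h, map_smul, inner_smul_left, inner_smul_right,
    ← mul_assoc, conj_mul_self_of_norm_one hc, one_mul, inner_alpha_eq_neg, neg_add_rev]

theorem alpha_zero (A : Op d) : alpha 0 A = A := by
  ext1 ψ
  refine ext_inner_left ℂ fun φ => ?_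
  rw [inner_alpha_eq_neg, neg_zero, tfShift_zero, tfShift_zero]

theorem alpha_comp (z : Phase d) (A B : Op d) : alpha z (A ∘L B) = alpha z A ∘L alpha z B := by
  ext1 ψ
  simp only [ContinuousLinearMap.comp_apply, alpha_apply, LinearIsometryEquiv.symm_apply_apply]

theorem adjoint_alpha (z : Phase d) (A : Op d) :
    ContinuousLinearMap.adjoint (alpha z A) = alpha z (ContinuousLinearMap.adjoint A) := by
  refine ((ContinuousLinearMap.eq_adjoint_iff _ _).2 fun φ ψ => ?_).symm
  rw [inner_alpha, ← inner_conj_symm, inner_alpha, inner_conj_symm,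
    ContinuousLinearMap.adjoint_inner_left]

theorem hsSq_alpha (z : Phase d) (A : Op d) : hsSq (alpha z A) = hsSq A := by
  have h1 : hsSq (alpha z A) = hsSq (A ∘L ContinuousLinearMap.adjoint (tfShift z : Op d)) :=
    hsSq_congr fun ψ => (tfShift z).norm_map _
  have h2 : hsSq ((tfShift z : Op d) ∘L ContinuousLinearMap.adjoint A) =
      hsSq (ContinuousLinearMap.adjoint A) := hsSq_congr fun ψ => (tfShift z).norm_map _
  rw [h1, ← hsSq_adjoint, ContinuousLinearMap.adjoint_comp, ContinuousLinearMap.adjoint_adjoint,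
    h2, hsSq_adjoint]

theorem coeFn_parity (ψ : L2 d) : parity d ψ =ᵐ[volume] fun t => ψ (-t) :=
  Lp.coeFn_compMeasurePreserving ψ (Measure.measurePreserving_neg volume)

theorem parity_parity (ψ : L2 d) : parity d (parity d ψ) = ψ := by
  refine Lp.ext ?_
  have h := (Measure.measurePreserving_neg (volume : Measure (Conf d))).quasiMeasurePreserving.ae
    (coeFn_parity ψ)
  filter_upwards [coeFn_parity (parity d ψ), h] with t h1 h2
  rw [h1, h2, neg_neg]

theorem inner_parity_parity (φ ψ : L2 d) :
    (inner ℂ (parity d φ) (parity d ψ) : ℂ) = inner ℂ φ ψ :=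
  LinearIsometry.inner_map_map (Lp.compMeasurePreservingₗᵢ ℂ (fun t : Conf d => -t)
    (Measure.measurePreserving_neg volume)) φ ψ

theorem inner_parity_left (φ ψ : L2 d) :
    (inner ℂ (parity d φ) ψ : ℂ) = inner ℂ φ (parity d ψ) := by
  rw [← inner_parity_parity, parity_parity]

theorem parity_tfShift_parity (z : Phase d) (ψ : L2 d) :
    parity d (tfShift z (parity d ψ)) = tfShift (-z) ψ := by
  refine Lp.ext ?_
  have hq := (Measure.measurePreserving_neg (volume : Measure (Conf d))).quasiMeasurePreserving
  have h2 := hq.ae (coeFn_tfShift z (parity d ψ))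
  have h3 := hq.ae ((measurePreserving_sub_right volume z.1).quasiMeasurePreserving.ae
    (coeFn_parity ψ))
  filter_upwards [coeFn_parity (tfShift z (parity d ψ)), h2, h3, coeFn_tfShift (-z) ψ]
    with t h1 h2 h3 h4
  rw [h1, h2, h3, h4]
  simp only [Prod.fst_neg, Prod.snd_neg, inner_neg_left, inner_neg_right]
  congr 2
  abel

theorem check_check (A : Op d) : check (check A) = A := by
  ext1 ψ
  simp only [check, ContinuousLinearMap.comp_apply, parity_parity]

theorem check_tensorSelf (φ : L2 d) : check (tensorSelf φ) = tensorSelf (parity d φ) := by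
  ext1 ψ
  simp only [check, tensorSelf, ContinuousLinearMap.comp_apply, InnerProductSpace.rankOne_apply,
    map_smul, inner_parity_left]

theorem alpha_tensorSelf (z : Phase d) (φ : L2 d) :
    alpha z (tensorSelf φ) = tensorSelf (tfShift z φ) := by
  ext1 ψ
  simp only [alpha_apply, tensorSelf, InnerProductSpace.rankOne_apply, map_smul]
  rw [← LinearIsometryEquiv.inner_map_map (tfShift z), LinearIsometryEquiv.apply_symm_apply]

/-- `Q_S(h)(z) = ⟨α_z(S) h, h⟩`. -/
theorem cohen_eq_inner (S : Op d) (h : L2 d) (z : Phase d) :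
    cohen S h z = inner ℂ h (alpha z S h) := by
  rw [cohen, opConv, check_tensorSelf, alpha_tensorSelf, tensorSelf, opTrace_comp_rankOne]
  simp only [check, ContinuousLinearMap.comp_apply]
  rw [← inner_parity_left, parity_tfShift_parity, inner_alpha_eq_neg]

theorem tilde_eq_opTrace (S : Op d) (z : Phase d) : tilde S z = opTrace (S ∘L alpha z S) := by
  rw [tilde, opConv, check_check]

end Alpha

/-! ### Translates of a set of finite perimeter -/

section Perimeter

variable {d : ℕ}

instance isAddHaarMeasure_volume_phase :
    (volume : Measure (Phase d)).IsAddHaarMeasure :=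
  inferInstanceAs ((volume : Measure (Conf d)).prod (volume : Measure (Conf d))).IsAddHaarMeasure

instance isNegInvariant_volume_phase : (volume : Measure (Phase d)).IsNegInvariant :=
  Measure.IsAddHaarMeasure.isNegInvariant_of_regular _

theorem euclNorm_nonneg (z : Phase d) : 0 ≤ euclNorm z := Real.sqrt_nonneg _

theorem euclNorm_smul (c : ℝ) (z : Phase d) : euclNorm (c • z) = |c| * euclNorm z := by
  rw [euclNorm, euclNorm, Prod.smul_fst, Prod.smul_snd, norm_smul, norm_smul, mul_pow, mul_pow,
    ← mul_add, Real.sqrt_mul (sq_nonneg _), Real.sqrt_sq (norm_nonneg c), Real.norm_eq_abs]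

theorem euclNorm_neg (z : Phase d) : euclNorm (-z) = euclNorm z := by
  simp [euclNorm]

theorem euclNorm_eq_zero {z : Phase d} (h : euclNorm z = 0) : z = 0 := by
  have h1 := (Real.sqrt_eq_zero (by positivity)).1 h
  have h2 : ‖z.1‖ = 0 := by nlinarith [sq_nonneg ‖z.1‖, sq_nonneg ‖z.2‖]
  have h3 : ‖z.2‖ = 0 := by nlinarith [sq_nonneg ‖z.1‖, sq_nonneg ‖z.2‖]
  exact Prod.ext (norm_eq_zero.1 h2) (norm_eq_zero.1 h3)

theorem divergence_smul_const {φ : Phase d → ℝ} (hφ : ContDiff ℝ 1 φ) (v z : Phase d) :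
    divergence (fun z => φ z • v) z = fderiv ℝ φ z v := by
  have h := ((hφ.differentiable (by norm_num)) z).hasFDerivAt.smul_const v
  rw [divergence, h.fderiv]
  exact LinearMap.trace_smulRight (fderiv ℝ φ z : Phase d →ₗ[ℝ] ℝ) v

/-- The definition of the perimeter tested on vector fields of constant direction. -/
theorem setIntegral_fderiv_le {Ω : Set (Phase d)} (hΩ : MeasurableSet Ω)
    (hper : perimeter Ω ≠ ∞) {φ : Phase d → ℝ} (hφ : ContDiff ℝ 1 φ) (hc : HasCompactSupport φ)
    (h1 : ∀ z, |φ z| ≤ 1) (v : Phase d) :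
    ∫ z in Ω, fderiv ℝ φ z v ≤ euclNorm v * (perimeter Ω).toReal := by
  rcases (euclNorm_nonneg v).eq_or_lt with h0 | h0
  · rw [euclNorm_eq_zero h0.symm]
    simp [euclNorm]
  let u : Phase d := (euclNorm v)⁻¹ • v
  have hu : euclNorm u = 1 := by
    rw [euclNorm_smul, abs_of_pos (by positivity), inv_mul_cancel₀ h0.ne']
  have hv : v = euclNorm v • u := by rw [smul_inv_smul₀ h0.ne']
  have key : ENNReal.ofReal (∫ z, Ω.indicator (fun _ => (1 : ℝ)) z *
      divergence (fun z => φ z • u) z) ≤ perimeter Ω := by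
    refine le_iSup_of_le (fun z => φ z • u) (le_iSup_of_le (hφ.smul contDiff_const)
      (le_iSup_of_le (hc.smul_right (f' := fun _ => u)) (le_iSup_of_le (fun z => ?_) le_rfl)))
    rw [euclNorm_smul, hu, mul_one]
    exact h1 z
  have e1 : ∫ z, Ω.indicator (fun _ => (1 : ℝ)) z * divergence (fun z => φ z • u) z =
      ∫ z in Ω, fderiv ℝ φ z u := by
    rw [← integral_indicator hΩ]
    refine integral_congr_ae (Eventually.of_forall fun z => ?_)
    by_cases hz : z ∈ Ω <;> simp [hz, divergence_smul_const hφ]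
  rw [e1, ENNReal.ofReal_le_iff_le_toReal hper] at key
  rw [hv]
  simp only [map_smul, smul_eq_mul]
  rw [integral_const_mul, ← hv]
  gcongr

/-- The difference quotient of `φ` in direction `w` is an average of directional derivatives of
translates of `φ`, to which the definition of the perimeter applies. -/
theorem setIntegral_sub_translate_le {Ω : Set (Phase d)} (hΩ : MeasurableSet Ω)
    (hfin : volume Ω ≠ ∞) (hper : perimeter Ω ≠ ∞) {φ : Phase d → ℝ} (hφ : ContDiff ℝ 1 φ)
    (hc : HasCompactSupport φ) (h1 : ∀ z, |φ z| ≤ 1) (w : Phase d) :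
    ∫ z in Ω, (φ z - φ (z + w)) ≤ euclNorm w * (perimeter Ω).toReal := by
  have hfd : Continuous (fderiv ℝ φ) := hφ.continuous_fderiv (by norm_num)
  let D : ℝ → Phase d → ℝ := fun s z => fderiv ℝ φ (z + s • w) (-w)
  have hD : Continuous (Function.uncurry D) := by
    have : Continuous fun p : ℝ × Phase d => fderiv ℝ φ (p.2 + p.1 • w) :=
      hfd.comp (by fun_prop)
    exact this.clm_apply continuous_const
  have hFTC : ∀ z, φ z - φ (z + w) = ∫ s in (0 : ℝ)..1, D s z := by
    intro z
    have hd : ∀ s ∈ Set.uIcc (0 : ℝ) 1, HasDerivAt (fun s : ℝ => -φ (z + s • w)) (D s z) s := by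
      intro s _
      have h2 : HasDerivAt (fun s : ℝ => z + s • w) w s := by
        simpa using ((hasDerivAt_id s).smul_const w).const_add z
      have h3 := (((hφ.differentiable (by norm_num)) (z + s • w)).hasFDerivAt.comp_hasDerivAt s
        h2).neg
      refine (h3.congr_deriv ?_)
      simp [D]
    rw [intervalIntegral.integral_eq_sub_of_hasDerivAt hd]
    · simp only [one_smul, zero_smul, add_zero]
      ring
    · exact (hD.comp (by fun_prop : Continuous fun s : ℝ => (s, z))).intervalIntegrable _ _
  have hint : Integrable (Function.uncurry D)
      ((volume.restrict (Set.uIoc (0 : ℝ) 1)).prod (volume.restrict Ω)) := by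
    have : IsFiniteMeasure (volume.restrict Ω) :=
      ⟨by rw [Measure.restrict_apply_univ]; exact hfin.lt_top⟩
    have : IsFiniteMeasure (volume.restrict (Set.uIoc (0 : ℝ) 1)) :=
      ⟨by rw [Measure.restrict_apply_univ, Set.uIoc_of_le zero_le_one]; simp⟩
    obtain ⟨C, hC⟩ := (hc.fderiv ℝ).exists_bound_of_continuous hfd
    refine Integrable.of_bound hD.aestronglyMeasurable (C * ‖w‖)
      (Eventually.of_forall fun p => ?_)
    refine ((fderiv ℝ φ (p.2 + p.1 • w)).le_opNorm (-w)).trans ?_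
    rw [norm_neg]
    gcongr
    exact hC _
  have hs : ∀ s, ∫ z in Ω, D s z ≤ euclNorm w * (perimeter Ω).toReal := by
    intro s
    have h4 := setIntegral_fderiv_le hΩ hper (φ := fun z => φ (z + s • w))
      (hφ.comp (contDiff_id.add contDiff_const))
      (hc.comp_homeomorph (Homeomorph.addRight (s • w))) (fun z => h1 _) (-w)
    rw [euclNorm_neg] at h4
    simpa only [fderiv_comp_add_right] using h4
  simp only [hFTC]
  rw [← intervalIntegral_integral_swap hint]
  have h5 := intervalIntegral.integral_mono_on (zero_le_one' ℝ)
    (f := fun s => ∫ z in Ω, D s z) (g := fun _ => euclNorm w * (perimeter Ω).toReal)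
    (by
      rw [intervalIntegrable_iff]
      exact hint.integral_prod_left) intervalIntegrable_const (fun s _ => hs s)
  simpa using h5

/-- A set of finite perimeter loses at most `|w| |∂Ω|` of its measure when it is intersected with
its translate by `-w`. -/
theorem volume_diff_translate_le {Ω : Set (Phase d)} (hΩ : IsCompact Ω)
    (hper : perimeter Ω ≠ ∞) (w : Phase d) :
    volume (Ω \ {z | z + w ∈ Ω}) ≤ ENNReal.ofReal (euclNorm w * (perimeter Ω).toReal) := by
  have hm := hΩ.measurableSet
  have hfin : volume Ω ≠ ∞ := hΩ.measure_lt_top.ne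
  refine ENNReal.le_of_forall_pos_le_add fun ε hε _ => ?_
  obtain ⟨U, hΩU, hU, hUε⟩ := hΩ.exists_isOpen_lt_add (μ := volume)
    (ε := (ε : ℝ≥0∞)) (by simpa using hε.ne')
  obtain ⟨K, hK, hΩK, hKU⟩ := exists_compact_between hΩ hU hΩU
  -- A smooth cutoff function which is `1` on `Ω` and `0` outside of `U`.
  obtain ⟨φ, hφ1, hφ0, hφI⟩ := exists_contMDiffMap_one_nhds_of_subset_interior
    (modelWithCornersSelf ℝ (Phase d)) (n := 1) hΩ.isClosed hΩK
  have hφ : ContDiff ℝ 1 φ := φ.contMDiff.contDiff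
  have hc : HasCompactSupport φ := HasCompactSupport.intro hK hφ0
  have hB := setIntegral_sub_translate_le hm hfin hper hφ hc
    (fun z => abs_le.2 ⟨by linarith [(hφI z).1], (hφI z).2⟩) w
  have hφΩ : ∀ z ∈ Ω, φ z = 1 := fun z hz => hφ1.self_of_nhdsSet z hz
  let V : Set (Phase d) := {z | z + w ∈ U}
  have hV : MeasurableSet V := (measurable_add_const w) hU.measurableSet
  have hmono : volume.real (Ω \ V) ≤ ∫ z in Ω, (φ z - φ (z + w)) := by
    have : ∫ z in Ω, (Vᶜ).indicator (fun _ => (1 : ℝ)) z = volume.real (Ω \ V) := by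
      rw [setIntegral_indicator hV.compl, setIntegral_const, smul_eq_mul, mul_one,
        Set.sdiff_eq]
    rw [← this]
    refine setIntegral_mono_on ?_ ?_ hm fun z hz => ?_
    · exact (integrableOn_const hfin).indicator hV.compl
    · have h1 : Continuous fun z => φ z - φ (z + w) :=
        hφ.continuous.sub (hφ.continuous.comp (continuous_add_const w))
      exact h1.continuousOn.integrableOn_compact hΩ
    · rw [hφΩ z hz]
      by_cases hzV : z ∈ V
      · simp [hzV, (hφI (z + w)).2]
      · rw [Set.indicator_of_mem hzV, hφ0 _ fun h => hzV (hKU h), sub_zero]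
  have hsub : Ω \ {z | z + w ∈ Ω} ⊆ (Ω \ V) ∪ {z | z + w ∈ U \ Ω} := by
    intro z hz
    by_cases hzV : z ∈ V
    · exact Or.inr ⟨hzV, hz.2⟩
    · exact Or.inl ⟨hz.1, hzV⟩
  have hdiff : volume {z : Phase d | z + w ∈ U \ Ω} ≤ ε := by
    have := measure_preimage_add_right (volume : Measure (Phase d)) w (U \ Ω)
    change volume ((fun z => z + w) ⁻¹' (U \ Ω)) ≤ ε
    rw [this, measure_sdiff hΩU hm.nullMeasurableSet hfin]
    exact tsub_le_iff_left.2 hUε.le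
  refine (measure_mono hsub).trans ((measure_union_le _ _).trans (add_le_add ?_ hdiff))
  rw [← ENNReal.ofReal_toReal (measure_ne_top_of_subset Set.sdiff_subset hfin)]
  exact ENNReal.ofReal_le_ofReal (hmono.trans hB)

end Perimeter

/-! ### Square roots of density operators -/

section SquareRoot

open ContinuousLinearMap (adjoint)

theorem exists_selfAdjoint_sqrt {E : Type*} [NormedAddCommGroup E] [InnerProductSpace ℂ E]
    [CompleteSpace E] {S : E →L[ℂ] E} (hS : S.IsPositive) :
    ∃ R : E →L[ℂ] E, adjoint R = R ∧ R ∘L R = S :=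
  ⟨CFC.sqrt S, (IsSelfAdjoint.of_nonneg (CFC.sqrt_nonneg S)).star_eq,
    CFC.sqrt_mul_sqrt_self S ((ContinuousLinearMap.nonneg_iff_isPositive S).2 hS)⟩

variable {d : ℕ}

instance separableSpace_L2 : TopologicalSpace.SeparableSpace (L2 d) := by
  have : Fact ((2 : ℝ≥0∞) ≠ ∞) := ⟨by norm_num⟩
  have : SecondCountableTopology (L2 d) := Lp.SecondCountableTopology
  infer_instance

/-- A density operator is the square of a self-adjoint Hilbert–Schmidt operator of norm one. -/
theorem IsDensityOperator.exists_sqrt {S : Op d} (hS : IsDensityOperator S) :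
    ∃ R : Op d, adjoint R = R ∧ R ∘L R = S ∧ hsSq R = 1 := by
  obtain ⟨R, hsa, hsq⟩ := exists_selfAdjoint_sqrt hS.2.1
  refine ⟨R, hsa, hsq, ?_⟩
  have h1 : ∀ i, (inner ℂ (basis (L2 d) i) (S (basis (L2 d) i)) : ℂ) =
      ((‖R (basis (L2 d) i)‖ ^ 2 : ℝ) : ℂ) := by
    intro i
    rw [← hsq, ContinuousLinearMap.comp_apply, ← ContinuousLinearMap.adjoint_inner_left, hsa,
      inner_self_eq_norm_sq_to_K]
    simp
  have htr := hS.2.2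
  rw [opTrace] at htr
  simp only [h1] at htr
  rw [← Complex.ofReal_tsum, Complex.ofReal_eq_one] at htr
  -- A divergent series would have the sum `0`.
  have hsum : Summable fun i => ‖R (basis (L2 d) i)‖ ^ 2 := by
    by_contra h
    rw [tsum_eq_zero_of_not_summable h] at htr
    exact zero_ne_one htr
  simp only [hsSq, ← ofReal_norm, ← ENNReal.ofReal_pow (norm_nonneg _)]
  rw [← ENNReal.ofReal_tsum_of_nonneg (fun i => by positivity) hsum, htr, ENNReal.ofReal_one]

/-- The function `S̃` for `S = R²` with `R` self-adjoint, written as the squared Hilbert–Schmidt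
norm of `α_z(R) R`. -/
def overlap (R : Op d) (z : Phase d) : ℝ≥0∞ := hsSq (alpha z R ∘L R)

theorem overlap_lt_top {R : Op d} (h : hsSq R ≠ ∞) (z : Phase d) : overlap R z < ∞ :=
  (hsSq_comp_le _ _).trans_lt (ENNReal.mul_lt_top (by finiteness) h.lt_top)

theorem adjoint_alpha_of_adjoint_eq {R : Op d} (hR : adjoint R = R) (z : Phase d) :
    adjoint (alpha z R) = alpha z R := by
  rw [adjoint_alpha, hR]

/-- The symmetry of `S̃`: the operator `α_{-z}(R) R` is unitarily equivalent to the adjoint of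
`α_z(R) R`. -/
theorem overlap_neg {R : Op d} (hR : adjoint R = R) (z : Phase d) :
    overlap R (-z) = overlap R z := by
  rw [overlap, ← hsSq_alpha z, alpha_comp, alpha_alpha, add_neg_cancel, alpha_zero, ← hsSq_adjoint,
    ContinuousLinearMap.adjoint_comp, hR, adjoint_alpha_of_adjoint_eq hR, overlap]

theorem measurable_overlap (R : Op d) : Measurable (overlap R) := by
  have := countable_basisIndex (E := L2 d)
  refine Measurable.tsum fun i => ?_
  exact ((continuous_alpha R (R (basis (L2 d) i))).enorm.measurable).pow_const 2

theorem tilde_eq_overlap {R : Op d} (hR : adjoint R = R) (h : hsSq R ≠ ∞) (z : Phase d) :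
    tilde (R ∘L R) z = ((overlap R z).toReal : ℂ) := by
  have h2 : adjoint (R ∘L alpha z (R ∘L R)) = alpha z (R ∘L R) ∘L R := by
    rw [ContinuousLinearMap.adjoint_comp, adjoint_alpha, ContinuousLinearMap.adjoint_comp, hR]
  have h3 : hsSq (R ∘L alpha z (R ∘L R)) ≠ ∞ := by
    rw [← hsSq_adjoint, h2]
    exact ((hsSq_comp_le _ _).trans_lt (ENNReal.mul_lt_top (by finiteness) h.lt_top)).ne
  have h4 := tsum_inner_apply_comm h h3
  rw [h2, hR] at h4
  rw [tilde_eq_opTrace, opTrace, overlap, toReal_hsSq, Complex.ofReal_tsum]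
  trans ∑' i, (inner ℂ (R (basis (L2 d) i)) ((R ∘L alpha z (R ∘L R)) (basis (L2 d) i)) : ℂ)
  · refine tsum_congr fun i => ?_
    rw [← ContinuousLinearMap.adjoint_inner_right, hR]
    rfl
  · rw [h4]
    refine tsum_congr fun i => ?_
    rw [alpha_comp, ContinuousLinearMap.comp_apply, ContinuousLinearMap.comp_apply,
      ← ContinuousLinearMap.adjoint_inner_right, adjoint_alpha_of_adjoint_eq hR,
      inner_self_eq_norm_sq_to_K]
    simp

theorem inner_alpha_sq {R : Op d} (hR : adjoint R = R) (z : Phase d) (φ : L2 d) :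
    (inner ℂ φ (alpha z (R ∘L R) φ) : ℂ) = ((‖alpha z R φ‖ ^ 2 : ℝ) : ℂ) := by
  rw [alpha_comp, ContinuousLinearMap.comp_apply, ← ContinuousLinearMap.adjoint_inner_left,
    adjoint_alpha_of_adjoint_eq hR, inner_self_eq_norm_sq_to_K]
  simp

/-- Moyal's identity for operators. -/
theorem lintegral_enorm_alpha_sq {R : Op d} (hR : adjoint R = R) (φ : L2 d) :
    ∫⁻ z, ‖alpha z R φ‖ₑ ^ 2 = hsSq R * ‖φ‖ₑ ^ 2 := by
  have := countable_basisIndex (E := L2 d)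
  have h1 : ∀ z : Phase d, ‖alpha z R φ‖ₑ ^ 2 =
      ∑' i, ‖(inner ℂ φ (tfShift z (R (basis (L2 d) i))) : ℂ)‖ₑ ^ 2 := by
    intro z
    rw [alpha_apply, ← ofReal_norm, LinearIsometryEquiv.norm_map, ofReal_norm,
      ← tsum_enorm_inner_sq (basis (L2 d))]
    refine tsum_congr fun i => ?_
    rw [← ContinuousLinearMap.adjoint_inner_left, hR, enorm_inner_comm,
      ← LinearIsometryEquiv.inner_map_map (tfShift z), LinearIsometryEquiv.apply_symm_apply]
  simp only [h1]
  rw [lintegral_tsum]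
  · simp only [lintegral_enorm_inner_tfShift_sq]
    rw [ENNReal.tsum_mul_left, mul_comm, hsSq]
  · intro i
    exact ((continuous_const.inner
      (continuous_tfShift (R (basis (L2 d) i)))).enorm.measurable.pow_const 2).aemeasurable

/-- For a density operator, `S̃` has integral one. -/
theorem lintegral_overlap {R : Op d} (hR : adjoint R = R) :
    ∫⁻ z, overlap R z = hsSq R ^ 2 := by
  have := countable_basisIndex (E := L2 d)
  simp only [overlap, hsSq, ContinuousLinearMap.comp_apply]
  rw [lintegral_tsum]
  · simp only [lintegral_enorm_alpha_sq hR]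
    rw [ENNReal.tsum_mul_left, sq, hsSq]
  · intro i
    exact ((continuous_alpha R (R (basis (L2 d) i))).enorm.measurable.pow_const 2).aemeasurable

end SquareRoot

/-! ### Spectral representations of mixed-state localization operators -/

section Spectral

open ContinuousLinearMap (adjoint)

variable {d : ℕ} {Ω : Set (Phase d)} {R : Op d} {ev : ℕ → ℝ} {h : ℕ → L2 d}

theorem integrable_charFn (hΩ : IsCompact Ω) : Integrable (charFn Ω) :=
  (integrable_indicator_iff hΩ.measurableSet).2 (integrableOn_const hΩ.measure_lt_top.ne)

theorem inner_funConv_charFn (hΩ : IsCompact Ω) (hR : adjoint R = R) (φ : L2 d) :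
    (inner ℂ φ (funConv (charFn Ω) (R ∘L R) φ) : ℂ) =
      ((∫ t in Ω, ‖alpha t R φ‖ ^ 2 : ℝ) : ℂ) := by
  rw [inner_funConv (integrable_charFn hΩ), ← integral_complex_ofReal,
    ← integral_indicator hΩ.measurableSet]
  refine integral_congr_ae (Eventually.of_forall fun t => ?_)
  by_cases ht : t ∈ Ω <;> simp [ht, charFn, inner_alpha_sq hR]

theorem ofReal_setIntegral_norm_alpha_sq (hΩ : IsCompact Ω) (φ : L2 d) :
    ENNReal.ofReal (∫ t in Ω, ‖alpha t R φ‖ ^ 2) = ∫⁻ t in Ω, ‖alpha t R φ‖ₑ ^ 2 := by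
  have hc : Continuous fun t : Phase d => ‖alpha t R φ‖ ^ 2 := (continuous_alpha R φ).norm.pow 2
  rw [ofReal_integral_eq_lintegral_ofReal (hc.continuousOn.integrableOn_compact hΩ)
    (Eventually.of_forall fun t => by positivity)]
  simp only [ENNReal.ofReal_pow (norm_nonneg _), ofReal_norm]

theorem IsSpectralRepresentation.hasSum_inner {T : Op d} (hs : IsSpectralRepresentation T ev h)
    (φ : L2 d) :
    HasSum (fun k => ((ev k * ‖(inner ℂ (h k) φ : ℂ)‖ ^ 2 : ℝ) : ℂ)) (inner ℂ φ (T φ)) := by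
  have h1 := (hs.hasSum.mapL (ContinuousLinearMap.apply ℂ (L2 d) φ)).mapL (innerSL ℂ φ)
  refine h1.congr_fun fun k => ?_
  simp only [ContinuousLinearMap.apply_apply, _root_.smul_apply, tensorSelf,
    InnerProductSpace.rankOne_apply, innerSL_apply_apply, inner_smul_right]
  rw [← inner_conj_symm φ (h k), Complex.mul_conj']
  push_cast
  rfl

/-- The eigenvalue `λ_k` is the mass of `Q_S(h_k)` on `Ω`. -/
theorem IsSpectralRepresentation.ev_eq (hΩ : IsCompact Ω) (hR : adjoint R = R)
    (hs : IsSpectralRepresentation (funConv (charFn Ω) (R ∘L R)) ev h) (k : ℕ) :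
    ev k = ∫ t in Ω, ‖alpha t R (h k)‖ ^ 2 := by
  have h1 := hs.hasSum_inner (h k)
  rw [inner_funConv_charFn hΩ hR, Complex.hasSum_ofReal] at h1
  refine HasSum.unique ?_ h1
  convert hasSum_single k ?_ using 1
  · simp [hs.orthonormal.1 k]
  · intro j hj
    simp [hs.orthonormal.2 hj]

theorem IsSpectralRepresentation.ofReal_ev (hΩ : IsCompact Ω) (hR : adjoint R = R)
    (hs : IsSpectralRepresentation (funConv (charFn Ω) (R ∘L R)) ev h) (k : ℕ) :
    ENNReal.ofReal (ev k) = ∫⁻ t in Ω, ‖alpha t R (h k)‖ₑ ^ 2 := by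
  rw [hs.ev_eq hΩ hR, ofReal_setIntegral_norm_alpha_sq hΩ]

theorem IsSpectralRepresentation.ev_nonneg (hΩ : IsCompact Ω) (hR : adjoint R = R)
    (hs : IsSpectralRepresentation (funConv (charFn Ω) (R ∘L R)) ev h) (k : ℕ) : 0 ≤ ev k := by
  rw [hs.ev_eq hΩ hR]
  exact integral_nonneg fun t => by positivity

theorem IsSpectralRepresentation.ev_le_one (hΩ : IsCompact Ω) (hR : adjoint R = R)
    (h1 : hsSq R = 1)
    (hs : IsSpectralRepresentation (funConv (charFn Ω) (R ∘L R)) ev h) (k : ℕ) : ev k ≤ 1 := by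
  rw [← ENNReal.ofReal_le_one, hs.ofReal_ev hΩ hR]
  refine (setLIntegral_le_lintegral _ _).trans ?_
  rw [lintegral_enorm_alpha_sq hR, h1, ← ofReal_norm, hs.orthonormal.1 k]
  simp

theorem IsSpectralRepresentation.tsum_quadraticForm (hΩ : IsCompact Ω) (hR : adjoint R = R)
    (hs : IsSpectralRepresentation (funConv (charFn Ω) (R ∘L R)) ev h) (φ : L2 d) :
    ∑' k, ENNReal.ofReal (ev k) * ‖(inner ℂ (h k) φ : ℂ)‖ₑ ^ 2 =
      ∫⁻ t in Ω, ‖alpha t R φ‖ₑ ^ 2 := by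
  have h1 := hs.hasSum_inner φ
  rw [inner_funConv_charFn hΩ hR, Complex.hasSum_ofReal] at h1
  rw [← ofReal_setIntegral_norm_alpha_sq hΩ, ← h1.tsum_eq, ENNReal.ofReal_tsum_of_nonneg _
    h1.summable]
  · refine tsum_congr fun k => ?_
    rw [ENNReal.ofReal_mul (hs.ev_nonneg hΩ hR k), ENNReal.ofReal_pow (norm_nonneg _), ofReal_norm]
  · exact fun k => mul_nonneg (hs.ev_nonneg hΩ hR k) (by positivity)

/-- The identity `∑ λ_k Q_S(h_k) = χ_Ω ∗ S̃`, obtained by computing the trace of `T α_z(S)`, for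
`T = χ_Ω ⋆ S`, once with the spectral representation and once with the integral. -/
theorem IsSpectralRepresentation.tsum_enorm_alpha_sq (hΩ : IsCompact Ω) (hR : adjoint R = R)
    (hs : IsSpectralRepresentation (funConv (charFn Ω) (R ∘L R)) ev h) (z : Phase d) :
    ∑' k, ENNReal.ofReal (ev k) * ‖alpha z R (h k)‖ₑ ^ 2 = ∫⁻ t in Ω, overlap R (z - t) := by
  have := countable_basisIndex (E := L2 d)
  have h1 : ∀ t, overlap R (z - t) = ∑' i, ‖alpha t R (alpha z R (basis (L2 d) i))‖ₑ ^ 2 := by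
    intro t
    rw [← overlap_neg hR, overlap, ← hsSq_alpha z, alpha_comp, alpha_alpha, neg_sub,
      add_sub_cancel]
    rfl
  simp only [h1]
  rw [lintegral_tsum fun i => ((continuous_alpha R _).enorm.measurable.pow_const 2).aemeasurable]
  simp only [← hs.tsum_quadraticForm hΩ hR]
  rw [ENNReal.tsum_comm]
  refine tsum_congr fun k => ?_
  rw [ENNReal.tsum_mul_left, ← tsum_enorm_inner_sq (basis (L2 d))]
  congr 1
  refine tsum_congr fun i => ?_
  rw [← ContinuousLinearMap.adjoint_inner_left, adjoint_alpha_of_adjoint_eq hR, enorm_inner_comm]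

end Spectral

/-! ### The mass outside of the first eigenvalues -/

/-- For a decreasing sequence in `[0, 1]` whose sum is at most `N`, the tail after `N` terms is
bounded by `∑ a_k (1 - a_k)`. -/
theorem tsum_sub_sum_range_le {a : ℕ → ℝ} (ha : Antitone a) (h0 : ∀ k, 0 ≤ a k)
    (h1 : ∀ k, a k ≤ 1) {V W : ℝ} (hV : HasSum a V) (hW : HasSum (fun k => a k ^ 2) W) {N : ℕ}
    (hN : V ≤ N) : V - ∑ k ∈ Finset.range N, a k ≤ V - W := by
  let e : ℕ → ℝ := fun k => if k ∈ Finset.range N then a N - a k else 0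
  have he : HasSum e (∑ k ∈ Finset.range N, (a N - a k)) := by
    have := hasSum_sum_of_ne_finset_zero (L := SummationFilter.unconditional ℕ) (f := e)
      (s := Finset.range N) (fun k hk => if_neg hk)
    rwa [Finset.sum_congr rfl fun k hk => if_pos hk] at this
  have hle := hasSum_le (L := SummationFilter.unconditional ℕ) (fun k => ?_)
    ((hV.mul_left (1 - a N)).add he) (hV.sub hW)
  · rw [Finset.sum_sub_distrib, Finset.sum_const, Finset.card_range, nsmul_eq_mul] at hle
    nlinarith [mul_nonneg (h0 N) (sub_nonneg.2 hN)]
  · -- The threshold `a N` separates the terms with `k < N` from those with `k ≥ N`.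
    by_cases hk : k ∈ Finset.range N
    · simp only [e, if_pos hk]
      have : a N ≤ a k := ha (Finset.mem_range.1 hk).le
      nlinarith [h1 k]
    · simp only [e, if_neg hk]
      have : a k ≤ a N := ha (not_lt.1 fun h => hk (Finset.mem_range.2 h))
      nlinarith [h0 k]

/-! ### The `L¹` estimate -/

section Estimate

open ContinuousLinearMap (adjoint)

variable {d : ℕ} {Ω : Set (Phase d)} {R : Op d} {ev : ℕ → ℝ} {h : ℕ → L2 d}

/-- The mass that `S̃` carries from `Ω` to its complement is controlled by the perimeter. -/
theorem setLIntegral_compl_overlap_le (hΩ : IsCompact Ω) (hper : perimeter Ω ≠ ∞) (R : Op d) :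
    ∫⁻ z in Ω, ∫⁻ t in Ωᶜ, overlap R (z - t) ≤
      ENNReal.ofReal (perimeter Ω).toReal *
        ∫⁻ w, overlap R w * ENNReal.ofReal (euclNorm w) := by
  have hm := hΩ.measurableSet
  have hg := measurable_overlap R
  have h1 : ∀ z, ∫⁻ t in Ωᶜ, overlap R (z - t) =
      ∫⁻ w, overlap R w * (Ωᶜ).indicator (fun _ => 1) (z - w) := by
    intro z
    rw [← lintegral_indicator hm.compl, ← lintegral_sub_left_eq_self _ z]
    refine lintegral_congr fun w => ?_
    by_cases hw : z - w ∈ Ωᶜ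
    · rw [Set.indicator_of_mem hw, Set.indicator_of_mem hw, sub_sub_cancel, mul_one]
    · rw [Set.indicator_of_notMem hw, Set.indicator_of_notMem hw, mul_zero]
  have hind : Measurable fun p : Phase d × Phase d =>
      (Ωᶜ).indicator (fun _ => (1 : ℝ≥0∞)) (p.1 - p.2) :=
    (measurable_const.indicator hm.compl).comp (measurable_fst.sub measurable_snd)
  simp only [h1]
  rw [lintegral_lintegral_swap ((hg.comp measurable_snd).mul hind).aemeasurable,
    ← lintegral_const_mul' _ _ ENNReal.ofReal_ne_top]
  refine lintegral_mono fun w => ?_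
  have hind' : Measurable fun z => (Ωᶜ).indicator (fun _ => (1 : ℝ≥0∞)) (z - w) :=
    hind.comp (measurable_id.prodMk measurable_const)
  rw [lintegral_const_mul _ hind']
  have h2 : ∫⁻ z in Ω, (Ωᶜ).indicator (fun _ => (1 : ℝ≥0∞)) (z - w) =
      volume (Ω \ {z | z + -w ∈ Ω}) := by
    have hms : MeasurableSet {z : Phase d | z + -w ∈ Ω} := (measurable_add_const (-w)) hm
    have h3 : ∀ z, (Ωᶜ).indicator (fun _ => (1 : ℝ≥0∞)) (z - w) =
        ({z : Phase d | z + -w ∈ Ω}ᶜ).indicator 1 z := by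
      intro z
      rw [sub_eq_add_neg]
      rfl
    simp only [h3]
    rw [lintegral_indicator_one hms.compl, Measure.restrict_apply hms.compl, Set.inter_comm,
      ← Set.sdiff_eq]
  rw [h2]
  refine (mul_le_mul_right (volume_diff_translate_le hΩ hper (-w)) _).trans_eq ?_
  rw [euclNorm_neg, ENNReal.ofReal_mul (euclNorm_nonneg w)]
  ring

/-- The convolution of `χ_Ω` with `overlap R` as a function with values in `[0, ∞]`. -/
def charConvOverlap (Ω : Set (Phase d)) (R : Op d) (z : Phase d) : ℝ≥0∞ :=
  ∫⁻ t in Ω, overlap R (z - t)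

theorem measurable_charConvOverlap (Ω : Set (Phase d)) (R : Op d) :
    Measurable (charConvOverlap Ω R) :=
  Measurable.lintegral_prod_right'
    (f := fun p : Phase d × Phase d => overlap R (p.1 - p.2))
    ((measurable_overlap R).comp (measurable_fst.sub measurable_snd))

theorem lintegral_charConvOverlap (Ω : Set (Phase d)) (hR : adjoint R = R) (h1 : hsSq R = 1) :
    ∫⁻ z, charConvOverlap Ω R z = volume Ω := by
  have hmeas : Measurable fun p : Phase d × Phase d => overlap R (p.1 - p.2) :=
    (measurable_overlap R).comp (measurable_fst.sub measurable_snd)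
  simp only [charConvOverlap]
  rw [lintegral_lintegral_swap hmeas.aemeasurable]
  simp only [lintegral_sub_right_eq_self, lintegral_overlap hR, h1]
  simp

theorem charConvOverlap_le_one (Ω : Set (Phase d)) (hR : adjoint R = R) (h1 : hsSq R = 1)
    (z : Phase d) : charConvOverlap Ω R z ≤ 1 := by
  refine (setLIntegral_le_lintegral _ _).trans ?_
  rw [lintegral_sub_left_eq_self (overlap R) z, lintegral_overlap hR, h1, one_pow]

theorem charConvTilde_eq (hΩ : IsCompact Ω) (hR : adjoint R = R) (h1 : hsSq R = 1)
    (z : Phase d) :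
    charConvTilde Ω (R ∘L R) z = ((charConvOverlap Ω R z).toReal : ℂ) := by
  have hne : hsSq R ≠ ∞ := by simp [h1]
  have hmeas : Measurable fun t => overlap R (z - t) :=
    (measurable_overlap R).comp (measurable_const.sub measurable_id)
  rw [charConvOverlap, ← integral_toReal hmeas.aemeasurable
    (Eventually.of_forall fun t => overlap_lt_top hne _), ← integral_complex_ofReal,
    ← integral_indicator hΩ.measurableSet, charConvTilde, convolution_def]
  refine integral_congr_ae (Eventually.of_forall fun t => ?_)
  by_cases ht : t ∈ Ω <;> simp [ht, charFn, tilde_eq_overlap hR hne]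

theorem integral_norm_alpha_sq (hR : adjoint R = R) (h1 : hsSq R = 1) {φ : L2 d}
    (hφ : ‖φ‖ = 1) :
    Integrable (fun z => ‖alpha z R φ‖ ^ 2) ∧ ∫ z, ‖alpha z R φ‖ ^ 2 = 1 := by
  have hc : Continuous fun t : Phase d => ‖alpha t R φ‖ ^ 2 := (continuous_alpha R φ).norm.pow 2
  have hl : ∫⁻ z, ENNReal.ofReal (‖alpha z R φ‖ ^ 2) = 1 := by
    simp only [ENNReal.ofReal_pow (norm_nonneg _), ofReal_norm]
    rw [lintegral_enorm_alpha_sq hR, h1, ← ofReal_norm, hφ]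
    simp
  have hnn : ∀ᵐ z : Phase d, 0 ≤ ‖alpha z R φ‖ ^ 2 := Eventually.of_forall fun z => by positivity
  constructor
  · refine ⟨hc.aestronglyMeasurable, ?_⟩
    rw [hasFiniteIntegral_iff_ofReal hnn, hl]
    exact ENNReal.one_lt_top
  · rw [integral_eq_lintegral_of_nonneg_ae hnn hc.aestronglyMeasurable, hl, ENNReal.toReal_one]

/-- Integrating `∑ λ_k Q_S(h_k) = χ_Ω ∗ S̃` over phase space. -/
theorem IsSpectralRepresentation.hasSum_ev (hΩ : IsCompact Ω) (hR : adjoint R = R)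
    (h1 : hsSq R = 1)
    (hs : IsSpectralRepresentation (funConv (charFn Ω) (R ∘L R)) ev h) :
    HasSum ev (volume.real Ω) := by
  have e1 : ∑' k, ENNReal.ofReal (ev k) = volume Ω := by
    rw [← lintegral_charConvOverlap Ω hR h1]
    simp only [charConvOverlap, ← hs.tsum_enorm_alpha_sq hΩ hR]
    rw [lintegral_tsum fun k => (((continuous_alpha R _).enorm.measurable.pow_const 2).const_mul
      _).aemeasurable]
    refine tsum_congr fun k => ?_
    rw [lintegral_const_mul' _ _ ENNReal.ofReal_ne_top, lintegral_enorm_alpha_sq hR, h1,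
      ← ofReal_norm, hs.orthonormal.1 k]
    simp
  have hnn := hs.ev_nonneg hΩ hR
  have hsum : Summable ev := by
    have := ENNReal.summable_toReal (e1.trans_ne hΩ.measure_lt_top.ne)
    simpa only [ENNReal.toReal_ofReal (hnn _)] using this
  rw [← ENNReal.ofReal_tsum_of_nonneg hnn hsum] at e1
  rw [Measure.real, ← e1, ENNReal.toReal_ofReal (tsum_nonneg hnn)]
  exact hsum.hasSum

/-- Integrating `∑ λ_k Q_S(h_k) = χ_Ω ∗ S̃` over `Ω`. -/
theorem IsSpectralRepresentation.hasSum_ev_sq (hΩ : IsCompact Ω) (hR : adjoint R = R)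
    (h1 : hsSq R = 1)
    (hs : IsSpectralRepresentation (funConv (charFn Ω) (R ∘L R)) ev h) :
    HasSum (fun k => ev k ^ 2) (∫⁻ z in Ω, charConvOverlap Ω R z).toReal := by
  have hnn := hs.ev_nonneg hΩ hR
  have e1 : ∑' k, ENNReal.ofReal (ev k ^ 2) = ∫⁻ z in Ω, charConvOverlap Ω R z := by
    simp only [charConvOverlap, ← hs.tsum_enorm_alpha_sq hΩ hR]
    rw [lintegral_tsum fun k => (((continuous_alpha R _).enorm.measurable.pow_const 2).const_mul
      _).aemeasurable]
    refine tsum_congr fun k => ?_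
    rw [lintegral_const_mul' _ _ ENNReal.ofReal_ne_top, ← hs.ofReal_ev hΩ hR,
      ← ENNReal.ofReal_mul (hnn k), sq]
  have hsum : Summable fun k => ev k ^ 2 := by
    refine Summable.of_nonneg_of_le (fun k => sq_nonneg _) (fun k => ?_)
      (hs.hasSum_ev hΩ hR h1).summable
    nlinarith [hnn k, hs.ev_le_one hΩ hR h1 k]
  rw [← ENNReal.ofReal_tsum_of_nonneg (fun k => sq_nonneg _) hsum] at e1
  rw [← e1, ENNReal.toReal_ofReal (tsum_nonneg fun k => sq_nonneg _)]
  exact hsum.hasSum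

/-- As `S̃` has integral one, `χ_Ω ∗ S̃` and `χ_{Ωᶜ} ∗ S̃` add up to `1`. -/
theorem setLIntegral_charConvOverlap_add (hΩ : IsCompact Ω) (hR : adjoint R = R)
    (h1 : hsSq R = 1) :
    (∫⁻ z in Ω, charConvOverlap Ω R z) + ∫⁻ z in Ω, ∫⁻ t in Ωᶜ, overlap R (z - t) =
      volume Ω := by
  rw [← lintegral_add_left (measurable_charConvOverlap Ω R)]
  have h2 : ∀ z, charConvOverlap Ω R z + ∫⁻ t in Ωᶜ, overlap R (z - t) = 1 := by
    intro z
    rw [charConvOverlap, lintegral_add_compl _ hΩ.measurableSet,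
      lintegral_sub_left_eq_self (overlap R), lintegral_overlap hR, h1, one_pow]
  simp only [h2]
  simp

/-- The `L¹` estimate in terms of the eigenvalues: `χ_Ω ∗ S̃` is the sum of all `λ_k Q_S(h_k)`, and
each `Q_S(h_k)` is nonnegative of integral one. -/
theorem integral_norm_accumulatedCohen_sub_le (hΩ : IsCompact Ω) (hR : adjoint R = R)
    (h1 : hsSq R = 1)
    (hs : IsSpectralRepresentation (funConv (charFn Ω) (R ∘L R)) ev h) :
    Integrable (fun z => accumulatedCohen (R ∘L R) Ω h z - charConvTilde Ω (R ∘L R) z) ∧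
      ∫ z, ‖accumulatedCohen (R ∘L R) Ω h z - charConvTilde Ω (R ∘L R) z‖ ≤
        (⌈volume.real Ω⌉₊ : ℝ) + volume.real Ω -
          2 * ∑ k ∈ Finset.range ⌈volume.real Ω⌉₊, ev k := by
  set N := ⌈volume.real Ω⌉₊
  let q : ℕ → Phase d → ℝ := fun k z => ‖alpha z R (h k)‖ ^ 2
  let G : Phase d → ℝ := fun z => (charConvOverlap Ω R z).toReal
  have hq : ∀ k, Integrable (q k) ∧ ∫ z, q k z = 1 := fun k =>
    integral_norm_alpha_sq hR h1 (hs.orthonormal.1 k)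
  have hGlt : ∀ z, charConvOverlap Ω R z ≠ ∞ := fun z =>
    ((charConvOverlap_le_one Ω hR h1 z).trans_lt ENNReal.one_lt_top).ne
  have hGi : Integrable G :=
    integrable_toReal_of_lintegral_ne_top (measurable_charConvOverlap Ω R).aemeasurable
      (by rw [lintegral_charConvOverlap Ω hR h1]; exact hΩ.measure_lt_top.ne)
  have hGint : ∫ z, G z = volume.real Ω := by
    rw [integral_toReal (measurable_charConvOverlap Ω R).aemeasurable
      (Eventually.of_forall fun z => (hGlt z).lt_top), lintegral_charConvOverlap Ω hR h1]
    rfl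
  have hnn := hs.ev_nonneg hΩ hR
  have hle := hs.ev_le_one hΩ hR h1
  have hρ : ∀ z, accumulatedCohen (R ∘L R) Ω h z - charConvTilde Ω (R ∘L R) z =
      ((∑ k ∈ Finset.range N, q k z - G z : ℝ) : ℂ) := by
    intro z
    rw [accumulatedCohen, charConvTilde_eq hΩ hR h1]
    simp only [cohen_eq_inner, inner_alpha_sq hR]
    simp only [N, q, G]
    push_cast
    rfl
  have hpart : ∀ z, ∑ k ∈ Finset.range N, ev k * q k z ≤ G z := by
    intro z
    rw [← ENNReal.ofReal_le_iff_le_toReal (hGlt z), ENNReal.ofReal_sum_of_nonneg fun k _ =>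
      mul_nonneg (hnn k) (by positivity), charConvOverlap, ← hs.tsum_enorm_alpha_sq hΩ hR]
    refine le_trans (Finset.sum_le_sum fun k _ => ?_) (ENNReal.sum_le_tsum (Finset.range N))
    rw [ENNReal.ofReal_mul (hnn k), ENNReal.ofReal_pow (norm_nonneg _), ofReal_norm]
  have hbound : ∀ z, |∑ k ∈ Finset.range N, q k z - G z| ≤
      ∑ k ∈ Finset.range N, (1 - ev k) * q k z +
        (G z - ∑ k ∈ Finset.range N, ev k * q k z) := by
    intro z
    have e : ∑ k ∈ Finset.range N, q k z - G z = ∑ k ∈ Finset.range N, (1 - ev k) * q k z -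
        (G z - ∑ k ∈ Finset.range N, ev k * q k z) := by
      simp only [sub_mul, one_mul, Finset.sum_sub_distrib]
      ring
    have p : 0 ≤ ∑ k ∈ Finset.range N, (1 - ev k) * q k z := Finset.sum_nonneg fun k _ =>
      mul_nonneg (sub_nonneg.2 (hle k)) (by positivity)
    rw [e]
    refine (abs_sub _ _).trans_eq ?_
    rw [abs_of_nonneg p, abs_of_nonneg (sub_nonneg.2 (hpart z))]
  have hi1 : Integrable fun z => ∑ k ∈ Finset.range N, (1 - ev k) * q k z :=
    integrable_finsetSum _ fun k _ => (hq k).1.const_mul _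
  have hi2 : Integrable fun z => ∑ k ∈ Finset.range N, ev k * q k z :=
    integrable_finsetSum _ fun k _ => (hq k).1.const_mul _
  have hi3 : Integrable fun z => ∑ k ∈ Finset.range N, q k z - G z :=
    (integrable_finsetSum _ fun k _ => (hq k).1).sub hGi
  simp only [hρ, Complex.norm_real, Real.norm_eq_abs]
  refine ⟨hi3.ofReal, (integral_mono hi3.abs (hi1.add (hGi.sub hi2)) hbound).trans_eq ?_⟩
  rw [integral_add' hi1 (hGi.sub hi2), integral_sub' hGi hi2, hGint,
    integral_finsetSum _ fun k _ => (hq k).1.const_mul _,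
    integral_finsetSum _ fun k _ => (hq k).1.const_mul _]
  simp only [integral_const_mul, (hq _).2, mul_one, Finset.sum_sub_distrib, Finset.sum_const,
    Finset.card_range, nsmul_eq_mul]
  ring

theorem mopStarNorm_sq (hR : adjoint R = R) (h1 : hsSq R = 1)
    (hint : Integrable fun z : Phase d => tilde (R ∘L R) z * (euclNorm z : ℂ)) :
    ENNReal.ofReal (mopStarNorm (R ∘L R) ^ 2) =
      ∫⁻ w, overlap R w * ENNReal.ofReal (euclNorm w) := by
  have hne : hsSq R ≠ ∞ := by simp [h1]
  have hnn : ∀ z : Phase d, 0 ≤ (overlap R z).toReal * euclNorm z := fun z =>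
    mul_nonneg ENNReal.toReal_nonneg (euclNorm_nonneg z)
  simp only [tilde_eq_overlap hR hne, ← Complex.ofReal_mul] at hint
  have hint' : Integrable fun z : Phase d => (overlap R z).toReal * euclNorm z := by
    simpa using hint.re
  simp only [mopStarNorm, tilde_eq_overlap hR hne, Complex.ofReal_re]
  rw [Real.sq_sqrt (integral_nonneg hnn),
    ofReal_integral_eq_lintegral_ofReal hint' (Eventually.of_forall hnn)]
  refine lintegral_congr fun z => ?_
  rw [ENNReal.ofReal_mul ENNReal.toReal_nonneg, ENNReal.ofReal_toReal (overlap_lt_top hne z).ne]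

end Estimate

end CohenClass

end

theorem mainTheorem6 {d : ℕ} (hd : 0 < d) (S : CohenClass.Op d) (hS : CohenClass.MemMopStar S)
    (Ω : Set (CohenClass.Phase d)) (hΩ : IsCompact Ω) (hpos : 0 < volume Ω)
    (hper : CohenClass.perimeter Ω < ∞)
    (ev : ℕ → ℝ) (h : ℕ → CohenClass.L2 d)
    (hspec : CohenClass.IsSpectralRepresentation
      (CohenClass.funConv (CohenClass.charFn Ω) S) ev h) :
    Integrable (fun z => CohenClass.accumulatedCohen S Ω h z - CohenClass.charConvTilde Ω S z) ∧
      1 / volume.real Ω *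
          (∫ z, ‖CohenClass.accumulatedCohen S Ω h z - CohenClass.charConvTilde Ω S z‖) ≤
        1 / volume.real Ω + 4 * CohenClass.mopStarNorm S *
          √((CohenClass.perimeter Ω).toReal / volume.real Ω) := by
  obtain ⟨R, hR, rfl, h1⟩ := hS.1.exists_sqrt
  have hfin : volume Ω ≠ ∞ := hΩ.measure_lt_top.ne
  obtain ⟨hint, hL⟩ := CohenClass.integral_norm_accumulatedCohen_sub_le hΩ hR h1 hspec
  refine ⟨hint, ?_⟩
  set V : ℝ := volume.real Ω with hV
  set P : ℝ := (CohenClass.perimeter Ω).toReal with hP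
  set m : ℝ := CohenClass.mopStarNorm (R ∘L R) with hm
  set D : ℝ := (∫⁻ z in Ω, ∫⁻ t in Ωᶜ, CohenClass.overlap R (z - t)).toReal with hD
  have hVpos : 0 < V := ENNReal.toReal_pos hpos.ne' hfin
  have hadd := CohenClass.setLIntegral_charConvOverlap_add hΩ hR h1
  have hW : (∫⁻ z in Ω, CohenClass.charConvOverlap Ω R z).toReal + D = V := by
    rw [hV, Measure.real, ← hadd, ENNReal.toReal_add]
    · exact ne_top_of_le_ne_top hfin (hadd ▸ le_self_add)
    · exact ne_top_of_le_ne_top hfin (hadd ▸ le_add_self)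
  have hDV : D ≤ V := by
    linarith [(ENNReal.toReal_nonneg : 0 ≤ (∫⁻ z in Ω, CohenClass.charConvOverlap Ω R z).toReal)]
  have hDP : D ≤ P * m ^ 2 := by
    have h2 := CohenClass.setLIntegral_compl_overlap_le hΩ hper.ne R
    rw [← CohenClass.mopStarNorm_sq hR h1 hS.2, ← ENNReal.ofReal_mul ENNReal.toReal_nonneg] at h2
    exact ENNReal.toReal_le_of_le_ofReal
      (mul_nonneg ENNReal.toReal_nonneg (sq_nonneg _)) h2
  have hceil : (⌈V⌉₊ : ℝ) ≤ V + 1 := (Nat.ceil_lt_add_one hVpos.le).le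
  have htail := CohenClass.tsum_sub_sum_range_le hspec.antitone (hspec.ev_nonneg hΩ hR)
    (hspec.ev_le_one hΩ hR h1) (hspec.hasSum_ev hΩ hR h1) (hspec.hasSum_ev_sq hΩ hR h1)
    (Nat.le_ceil V)
  have hm0 : 0 ≤ m := Real.sqrt_nonneg _
  have hD0 : 0 ≤ D := ENNReal.toReal_nonneg
  have hP0 : 0 ≤ P := ENNReal.toReal_nonneg
  -- The geometric mean of the bounds `D ≤ V` and `D ≤ P m²`.
  have hDm : D / V ≤ m * √(P / V) := by
    refine abs_le_of_sq_le_sq' ?_ (by positivity) |>.2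
    rw [mul_pow, Real.sq_sqrt (by positivity), div_pow, sq V, ← mul_div_assoc, div_le_div_iff₀
      (by positivity) hVpos]
    have : D ^ 2 ≤ V * (P * m ^ 2) := by
      rw [sq]
      exact mul_le_mul hDV hDP hD0 hVpos.le
    nlinarith [mul_le_mul_of_nonneg_right this hVpos.le]
  have hmain : 1 / V * (∫ z, ‖CohenClass.accumulatedCohen (R ∘L R) Ω h z -
      CohenClass.charConvTilde Ω (R ∘L R) z‖) ≤ 1 / V * (1 + 2 * D) := by
    gcongr
    linarith
  calc _ ≤ _ := hmain
    _ = 1 / V + 2 * (D / V) := by ring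
    _ ≤ 1 / V + 4 * m * √(P / V) := by
        have : 0 ≤ m * √(P / V) := by positivity
        linarith
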